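/- Let $\sigma_1,\sigma_2,\sigma_3$ be the Pauli matrices, $\alpha_k=\begin{pmatrix}0&\sigma_k\\ \sigma_k&0\end{pmatrix}$ ($k=1,2,3$) and $\beta=\begin{pmatrix}\mathbf 1_2&0\\0&-\mathbf 1_2\end{pmatrix}$ the Dirac matrices in standard representation, and put $M^-_k=\alpha_k\otimes\mathbf 1_4-\mathbf 1_4\otimes\alpha_k$ and $B=2\,\beta\otimes\beta$ (complex $16\times16$ matrices acting on $\mathbb C^{16}=\mathbb C^4\otimes\mathbb C^4$). Let $\mathcal H^{\mathrm{rel}}=\mathbb C^{16}\otimes L^2(\mathbb R^3)$ with its usual norm and scalar product. Let $\hat{\mathbf p}=-i\nabla$; for a function $m$ on $\mathbb R^3$, scalar- or matrix-valued, $m(\hat{\mathbf p})$ denotes the Fourier multiplier with symbol $m(\mathbf p)$ on its natural domain $\{f\in\mathcal H^{\mathrm{rel}} : m(\hat{\mathbf p})f\in\mathcal H^{\mathrm{rel}}\}$; thus, with $\hat f(\xi)=\int e^{-2\pi i \mathbf r\cdot\xi}f(\mathbf r)\,d\mathbf r$, $\widehat{m(\hat{\mathbf p})f}(\xi)=m(2\pi\xi)\hat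 f(\xi)$. Put $$\tau(\mathbf p)=-\frac{(\alpha\cdot\mathbf p)\otimes(\alpha\cdot\mathbf p)}{|\mathbf p|^2},\quad P_+(\mathbf p)=\tfrac12(\mathbf 1_{16}+\tau(\mathbf p)),\quad P_+=P_+(\hat{\mathbf p}),\quad \mathcal H^{\mathrm{rel}}_+=P_+\mathcal H^{\mathrm{rel}},$$ $$\mathcal D_+=(\mathbb C^{16}\otimes H^1(\mathbb R^3))\cap\mathcal H^{\mathrm{rel}}_+ .$$ Let $A_0=M^-\cdot\hat{\mathbf p}+BP_+$ in $\mathcal H^{\mathrm{rel}}_+$ with domain $\mathcal D_+$, and let $|A_0|$ be its absolute value, that is, the Fourier multiplier whose symbol is the matrix absolute value $|A_0(\mathbf p)|=(A_0(\mathbf p)^\dagger A_0(\mathbf p))^{1/2}$ of $A_0(\mathbf p)=M^-\cdot\mathbf p+BP_+(\mathbf p)$, on its natural domain in $\mathcal H^{\mathrm{rel}}_+$. For $\kappa\in(0,1]$ and $\lambda\in\{\kappa,\kappa/2\}$ let $$M_\lambda=2^{-\lambda}\,\frac{\Gamma(\frac34-\frac\lambda2)}{\Gamma(\frac34+\frac\lambda2)}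 .$$ Let $0<\kappa\le1$. Then: (a) For all $f\in\mathcal D_+$, the function $|\cdot|^{-\kappa}f$ belongs to $\mathcal H^{\mathrm{rel}}$ and $$\big\||\cdot|^{-\kappa}f\big\|\le\frac{M_\kappa}{2}\,\|A_0f\| .$$ (b) For all $f\in(\mathbb C^{16}\otimes H^{1/2}(\mathbb R^3))\cap\mathcal H^{\mathrm{rel}}_+$, the quadratic forms $\langle f,|\cdot|^{-\kappa}f\rangle=\int|\mathbf r|^{-\kappa}|f(\mathbf r)|^2\,d\mathbf r$ and $\langle f,|A_0|f\rangle=\int\langle\hat f(\xi),|A_0(2\pi\xi)|\hat f(\xi)\rangle\,d\xi$ are finite (the integrands are integrable) and $$\langle f,|\cdot|^{-\kappa}f\rangle\le\frac{M_{\kappa/2}^2}{2}\,\langle f,|A_0|f\rangle .$$ Moreover, $|A_0|$ has domain $\mathcal D_+$, and $|A_0|f=2(\hat p^2+1)^{1/2}P_+f$ for all $f\in\mathcal D_+$. -/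

import Mathlib

open MeasureTheory FourierTransform
open scoped Kronecker ENNReal

noncomputable section

namespace TwoBodyDirac

/-- Position space `ℝ³` with the Euclidean norm. -/
abbrev R3 : Type := EuclideanSpace ℝ (Fin 3)

/-- The index set of `ℂ¹⁶ = ℂ⁴ ⊗ ℂ⁴`. -/
abbrev SpinIdx : Type := Fin 4 × Fin 4

/-- The spinor space `ℂ¹⁶ = ℂ⁴ ⊗ ℂ⁴`. -/
abbrev Spinor : Type := EuclideanSpace ℂ SpinIdx

/-- The Hilbert space `ℋ^rel = ℂ¹⁶ ⊗ L²(ℝ³)`. -/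
abbrev Hrel : Type := Lp Spinor 2 (volume : Measure R3)

/-! ### Dirac matrices -/

/-- The Pauli matrices. -/
def pauli : Fin 3 → Matrix (Fin 2) (Fin 2) ℂ :=
  ![!![0, 1; 1, 0], !![0, -Complex.I; Complex.I, 0], !![1, 0; 0, -1]]

/-- The Dirac matrices `α₁, α₂, α₃` in standard representation. -/
def alpha (k : Fin 3) : Matrix (Fin 4) (Fin 4) ℂ :=
  Matrix.reindex finSumFinEquiv finSumFinEquiv (Matrix.fromBlocks 0 (pauli k) (pauli k) 0)

/-- The Dirac matrix `β` in standard representation. -/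
def beta : Matrix (Fin 4) (Fin 4) ℂ :=
  Matrix.reindex finSumFinEquiv finSumFinEquiv
    (Matrix.fromBlocks (1 : Matrix (Fin 2) (Fin 2) ℂ) 0 0 (-1 : Matrix (Fin 2) (Fin 2) ℂ))

/-- `M⁻ₖ = αₖ ⊗ 1 - 1 ⊗ αₖ`. -/
def Mminus (k : Fin 3) : Matrix SpinIdx SpinIdx ℂ :=
  alpha k ⊗ₖ (1 : Matrix (Fin 4) (Fin 4) ℂ) - (1 : Matrix (Fin 4) (Fin 4) ℂ) ⊗ₖ alpha k

/-- `B = 2 β ⊗ β`. -/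
def B : Matrix SpinIdx SpinIdx ℂ := (2 : ℂ) • (beta ⊗ₖ beta)

/-! ### Matrix symbols, as functions of the momentum `p ∈ ℝ³` -/

/-- `α · p`. -/
def alphaDot (p : R3) : Matrix (Fin 4) (Fin 4) ℂ := ∑ k, (p k : ℂ) • alpha k

/-- `M⁻ · p`. -/
def MminusDot (p : R3) : Matrix SpinIdx SpinIdx ℂ := ∑ k, (p k : ℂ) • Mminus k

/-- `τ(p) = - (α · p ⊗ α · p) / p²`. -/
def tauSymbol (p : R3) : Matrix SpinIdx SpinIdx ℂ :=
  -(((‖p‖ ^ 2)⁻¹ : ℝ) : ℂ) • (alphaDot p ⊗ₖ alphaDot p)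

/-- `P₊(p) = (1 + τ(p)) / 2`. -/
def PplusSymbol (p : R3) : Matrix SpinIdx SpinIdx ℂ := (1 / 2 : ℂ) • (1 + tauSymbol p)

/-- `A₀(p) = M⁻ · p + B P₊(p)`. -/
def A0Symbol (p : R3) : Matrix SpinIdx SpinIdx ℂ := MminusDot p + B * PplusSymbol p

open scoped MatrixOrder in
/-- The matrix absolute value `|A₀(p)| = (A₀(p)† A₀(p))^{1/2}`. -/
def absA0Symbol (p : R3) : Matrix SpinIdx SpinIdx ℂ := CFC.abs (A0Symbol p)

/-! ### Functions of the momentum operator -/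

/-- A matrix acting on spinors. -/
abbrev act (A : Matrix SpinIdx SpinIdx ℂ) : Spinor →L[ℂ] Spinor :=
  Matrix.toEuclideanCLM (𝕜 := ℂ) A

/-- The function `ξ ↦ m(2πξ) f̂(ξ)`. As the Fourier transform `𝓕` has the kernel `exp(-2πi r·ξ)`,
the momentum operator `-i∇` is multiplication by `2πξ` on the Fourier side, so this is the
Fourier transform of `m(-i∇) f`. -/
def momentumMul (m : R3 → Matrix SpinIdx SpinIdx ℂ) (f : Hrel) : R3 → Spinor :=
  fun ξ => act (m ((2 * Real.pi) • ξ)) ((𝓕 f : Hrel) ξ)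

theorem momentumMul_add (m : R3 → Matrix SpinIdx SpinIdx ℂ) (f g : Hrel) :
    momentumMul m (f + g) =ᵐ[volume] momentumMul m f + momentumMul m g := by
  have h : (𝓕 (f + g) : Hrel) = 𝓕 f + 𝓕 g := FourierAdd.fourier_add f g
  filter_upwards [Lp.coeFn_add (𝓕 f : Hrel) (𝓕 g)] with ξ hξ
  simp only [momentumMul, h, Pi.add_apply, hξ, map_add]

theorem momentumMul_smul (m : R3 → Matrix SpinIdx SpinIdx ℂ) (c : ℂ) (f : Hrel) :
    momentumMul m (c • f) =ᵐ[volume] c • momentumMul m f := by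
  have h : (𝓕 (c • f) : Hrel) = c • 𝓕 f := FourierSMul.fourier_smul c f
  filter_upwards [Lp.coeFn_smul c (𝓕 f : Hrel)] with ξ hξ
  simp only [momentumMul, h, Pi.smul_apply, hξ, map_smul]

/-- The operator `m(p̂)`, `p̂ = -i∇`, on its natural domain
`{f ∈ ℋ^rel | m(p̂) f ∈ ℋ^rel}`. -/
def momentumOp (m : R3 → Matrix SpinIdx SpinIdx ℂ) : Hrel →ₗ.[ℂ] Hrel where
  domain :=
    { carrier := {f | MemLp (momentumMul m f) 2 volume}
      zero_mem' := by
        have h := momentumMul_smul m 0 0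
        simp only [zero_smul] at h
        exact (memLp_congr_ae h).2 MemLp.zero
      add_mem' := fun {f g} hf hg => (memLp_congr_ae (momentumMul_add m f g)).2 (hf.add hg)
      smul_mem' := fun c f hf => (memLp_congr_ae (momentumMul_smul m c f)).2 (hf.const_smul c) }
  toFun :=
    { toFun := fun f => 𝓕⁻ (MemLp.toLp (momentumMul m f.1) f.2 : Hrel)
      map_add' := fun f g => by
        rw [← FourierInvAdd.fourierInv_add, ← MemLp.toLp_add]
        congr 1
        exact MemLp.toLp_congr _ _ (momentumMul_add m f.1 g.1)
      map_smul' := fun c f => by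
        rw [RingHom.id_apply, ← FourierInvSMul.fourierInv_smul, ← MemLp.toLp_const_smul]
        congr 1
        exact MemLp.toLp_congr _ _ (momentumMul_smul m c f.1) }

/-- The free relative Hamiltonian `M⁻ · p̂` on its natural domain. -/
def MminusOp : Hrel →ₗ.[ℂ] Hrel := momentumOp MminusDot

/-- The operator `(p̂² + 1)^{1/2}` on its natural domain. -/
def sqrtOp : Hrel →ₗ.[ℂ] Hrel :=
  momentumOp (fun p => ((Real.sqrt (‖p‖ ^ 2 + 1) : ℝ) : ℂ) • 1)

theorem memLp_mul_of_bounded {c : R3 → ℂ} (hc : Measurable c) {C : ℝ} (hC : ∀ x, ‖c x‖ ≤ C)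
    {g : R3 → Spinor} (hg : MemLp g 2 volume) (T : Spinor →L[ℂ] Spinor) :
    MemLp (fun x => c x • T (g x)) 2 volume := by
  have hT : MemLp (fun x => T (g x)) 2 volume := T.comp_memLp' hg
  refine MemLp.of_le_mul (c := C) hT (hc.aestronglyMeasurable.smul hT.1) ?_
  filter_upwards with x
  rw [norm_smul]
  gcongr
  exact hC x

theorem tauSymbol_eq (p : R3) : tauSymbol p = ∑ j : Fin 3, ∑ k : Fin 3,
    (-(((‖p‖ ^ 2)⁻¹ * (p j * p k) : ℝ) : ℂ)) • (alpha j ⊗ₖ alpha k) := by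
  ext a b
  simp only [tauSymbol, alphaDot, Matrix.smul_apply, Matrix.kroneckerMap_apply, Matrix.sum_apply,
    smul_eq_mul]
  rw [Finset.sum_mul_sum, Finset.mul_sum]
  simp only [Finset.mul_sum]
  refine Finset.sum_congr rfl fun j _ => Finset.sum_congr rfl fun k _ => ?_
  push_cast
  ring

theorem tau_domain (f : Hrel) : f ∈ (momentumOp tauSymbol).domain := by
  change MemLp (momentumMul tauSymbol f) 2 volume
  have key : momentumMul tauSymbol f = fun ξ => ∑ j : Fin 3, ∑ k : Fin 3,
      (-(((‖(2 * Real.pi) • ξ‖ ^ 2)⁻¹ * (((2 * Real.pi) • ξ) j * ((2 * Real.pi) • ξ) k) : ℝ) : ℂ)) •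
        act (alpha j ⊗ₖ alpha k) ((𝓕 f : Hrel) ξ) := by
    funext ξ
    simp only [momentumMul, tauSymbol_eq, map_sum, map_smul, sum_apply, smul_apply]
  rw [key]
  refine memLp_finsetSum _ fun j _ => memLp_finsetSum _ fun k _ => ?_
  refine memLp_mul_of_bounded (C := 1) (by fun_prop) (fun ξ => ?_) (Lp.memLp _) _
  rw [norm_neg, Complex.norm_real, Real.norm_eq_abs, abs_mul, abs_mul, abs_inv,
    abs_of_nonneg (sq_nonneg _)]
  have hj := PiLp.norm_apply_le ((2 * Real.pi) • ξ) j
  have hk := PiLp.norm_apply_le ((2 * Real.pi) • ξ) k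
  rw [Real.norm_eq_abs] at hj hk
  refine inv_mul_le_one_of_le₀ ?_ (sq_nonneg _)
  rw [sq]
  exact mul_le_mul hj hk (abs_nonneg _) (norm_nonneg _)

/-- The bounded operator `τ`, the Fourier multiplier with symbol `τ(p)`, on all of `ℋ^rel`. -/
def tau : Hrel →ₗ[ℂ] Hrel :=
  (momentumOp tauSymbol).toFun ∘ₗ LinearMap.id.codRestrict _ tau_domain

/-- The orthogonal projection `P₊ = (id + τ) / 2`. -/
def Pplus : Hrel →ₗ[ℂ] Hrel := (1 / 2 : ℂ) • (LinearMap.id + tau)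

/-- `ℋ^rel₊ = P₊ ℋ^rel`. -/
def Hplus : Submodule ℂ Hrel := LinearMap.range Pplus

/-! ### Sobolev spaces and operator domains -/

/-- The Sobolev space `ℂ¹⁶ ⊗ H^s(ℝ³)` as a subspace of `ℋ^rel`. -/
def Sobolev (s : ℝ) : Submodule ℂ Hrel where
  carrier := {f | TemperedDistribution.MemSobolev s 2 (Lp.toTemperedDistribution f)}
  zero_mem' := by
    have : Lp.toTemperedDistribution (0 : Hrel) = 0 := map_zero (Lp.toTemperedDistributionCLM _ _ _)
    simp [this]
  add_mem' := fun {f g} hf hg => by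
    have : Lp.toTemperedDistribution (f + g) = Lp.toTemperedDistribution f +
      Lp.toTemperedDistribution g := map_add (Lp.toTemperedDistributionCLM _ _ _) f g
    simpa [this] using TemperedDistribution.MemSobolev.add hf hg
  smul_mem' := fun c f hf => by
    have : Lp.toTemperedDistribution (c • f) = c • Lp.toTemperedDistribution f :=
      map_smul (Lp.toTemperedDistributionCLM _ _ _) c f
    simpa [this] using TemperedDistribution.MemSobolev.smul c hf

/-- `𝒟₊ = (ℂ¹⁶ ⊗ H¹(ℝ³)) ∩ ℋ^rel₊`. -/
def Dplus : Submodule ℂ Hrel := Sobolev 1 ⊓ Hplus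

theorem sobolev_fourier {s : ℝ} (hs : 0 ≤ s) {f : Hrel} (hf : f ∈ Sobolev s) :
    ∃ g : Hrel, (𝓕 f : Hrel) =ᵐ[volume]
      fun ξ => (((1 + ‖ξ‖ ^ 2) ^ (-s / 2) : ℝ) : ℂ) • g ξ := by
  obtain ⟨u, hu⟩ := TemperedDistribution.memSobolev_iff_exists_smulLeftCLM_fourier.1 hf
  rw [Lp.fourier_toTemperedDistribution_eq] at hu
  have hw : MemLp (fun ξ : R3 => (((1 + ‖ξ‖ ^ 2) ^ (-s / 2) : ℝ) : ℂ)) ∞ volume := by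
    have hc : Measurable (fun ξ : R3 => (((1 + ‖ξ‖ ^ 2) ^ (-s / 2) : ℝ) : ℂ)) := by fun_prop
    refine memLp_top_of_bound (C := 1) hc.aestronglyMeasurable ?_
    filter_upwards with ξ
    rw [Complex.norm_real, Real.norm_eq_abs, abs_of_nonneg (by positivity)]
    exact Real.rpow_le_one_of_one_le_of_nonpos (by nlinarith [sq_nonneg ‖ξ‖]) (by linarith)
  have hF : Lp.toTemperedDistribution (𝓕 f : Hrel) =
      Lp.toTemperedDistribution (hw.toLp • u : Hrel) := by
    rw [Lp.toTemperedDistribution_smul_eq (by fun_prop), ← hu,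
      TemperedDistribution.smulLeftCLM_smulLeftCLM_apply (by fun_prop) (by fun_prop)]
    convert! (TemperedDistribution.smulLeftCLM_const 1 (Lp.toTemperedDistribution (𝓕 f : Hrel))).symm using 1
    · simp
    · congr
      ext x
      rw [Pi.mul_apply]
      norm_cast
      rw [← Real.rpow_add (by positivity)]
      ring_nf
      simp
  have hF' : (𝓕 f : Hrel) = hw.toLp • u :=
    LinearMap.ker_eq_bot.1 (Lp.ker_toTemperedDistributionCLM_eq_bot (F := Spinor)
      (μ := (volume : Measure R3)) (p := 2)) hF
  refine ⟨u, ?_⟩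
  rw [hF']
  filter_upwards [Lp.coeFn_lpSMul (r := 2) (hw.toLp) u, hw.coeFn_toLp] with ξ h1 h2
  rw [h1, Pi.smul_apply', h2]

theorem Dplus_le : Dplus ≤ MminusOp.domain := by
  intro f hf
  obtain ⟨g, hg⟩ := sobolev_fourier zero_le_one hf.1
  change MemLp (momentumMul MminusDot f) 2 volume
  have key : momentumMul MminusDot f =ᵐ[volume] fun ξ => ∑ k : Fin 3,
      ((((2 * Real.pi) • ξ) k * (1 + ‖ξ‖ ^ 2) ^ (-1 / 2 : ℝ) : ℝ) : ℂ) •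
        act (Mminus k) (g ξ) := by
    filter_upwards [hg] with ξ hξ
    simp only [momentumMul, MminusDot, hξ, map_sum, map_smul, sum_apply, smul_apply, Finset.smul_sum, smul_smul]
    refine Finset.sum_congr rfl fun k _ => ?_
    push_cast
    rw [mul_comm]
  refine (memLp_congr_ae key).2 (memLp_finsetSum _ fun k _ => ?_)
  refine memLp_mul_of_bounded (C := 2 * Real.pi) (by fun_prop) (fun ξ => ?_) (Lp.memLp _) _
  have hk := PiLp.norm_apply_le ξ k
  have h0 : (0 : ℝ) < 1 + ‖ξ‖ ^ 2 := by positivity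
  have h1 : |ξ k| ≤ (1 + ‖ξ‖ ^ 2) ^ (1 / 2 : ℝ) := by
    rw [← Real.sqrt_eq_rpow]
    refine Real.le_sqrt_of_sq_le ?_
    rw [Real.norm_eq_abs] at hk
    nlinarith [abs_nonneg (ξ k)]
  rw [Complex.norm_real, Real.norm_eq_abs, abs_mul, abs_of_nonneg (a := _ ^ _) (by positivity),
    PiLp.smul_apply, smul_eq_mul, abs_mul, abs_of_nonneg (a := 2 * Real.pi) (by positivity),
    mul_assoc]
  refine mul_le_of_le_one_right (by positivity) ?_
  calc |ξ k| * (1 + ‖ξ‖ ^ 2) ^ (-1 / 2 : ℝ)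
      ≤ (1 + ‖ξ‖ ^ 2) ^ (1 / 2 : ℝ) * (1 + ‖ξ‖ ^ 2) ^ (-1 / 2 : ℝ) := by gcongr
    _ = 1 := by rw [← Real.rpow_add h0]; norm_num

/-- The operator `A₀ = M⁻ · p̂ + B P₊` with domain `𝒟₊`. -/
def A0 : Hrel →ₗ.[ℂ] Hrel where
  domain := Dplus
  toFun := MminusOp.toFun ∘ₗ Submodule.inclusion Dplus_le +
    ((act B).compLpL 2 volume).toLinearMap ∘ₗ Pplus ∘ₗ Dplus.subtype

/-- The absolute value `|A₀|` in `ℋ^rel₊`: the Fourier multiplier with symbol `|A₀(p)|`, on its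
natural domain in `ℋ^rel₊`. -/
def absA0 : Hrel →ₗ.[ℂ] Hrel := (momentumOp absA0Symbol).domRestrict Hplus

/-- The integrand of the quadratic form
`⟨f, |A₀| f⟩ = ∫ ⟨f̂(ξ), |A₀(2πξ)| f̂(ξ)⟩ dξ` of the nonnegative operator `|A₀|`. -/
def absA0Density (f : Hrel) (ξ : R3) : ℝ :=
  (inner ℂ ((𝓕 f : Hrel) ξ) (momentumMul absA0Symbol f ξ)).re

/-! ### The interaction potential -/

/-- The function `r ↦ |r|^{-κ} f(r)`. -/
def potentialMul (κ : ℝ) (f : Hrel) : R3 → Spinor :=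
  fun r => ((‖r‖ ^ (-κ) : ℝ) : ℂ) • f r

theorem potentialMul_add (κ : ℝ) (f g : Hrel) :
    potentialMul κ (f + g) =ᵐ[volume] potentialMul κ f + potentialMul κ g := by
  filter_upwards [Lp.coeFn_add f g] with r hr
  simp only [potentialMul, hr, Pi.add_apply, smul_add]

theorem potentialMul_smul (κ : ℝ) (c : ℂ) (f : Hrel) :
    potentialMul κ (c • f) =ᵐ[volume] c • potentialMul κ f := by
  filter_upwards [Lp.coeFn_smul c f] with r hr
  simp only [potentialMul, hr, Pi.smul_apply]
  rw [smul_comm]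

/-- The operator `V` of multiplication by `|r|^{-κ}` on its natural domain. -/
def potential (κ : ℝ) : Hrel →ₗ.[ℂ] Hrel where
  domain :=
    { carrier := {f | MemLp (potentialMul κ f) 2 volume}
      zero_mem' := by
        have h := potentialMul_smul κ 0 0
        simp only [zero_smul] at h
        exact (memLp_congr_ae h).2 MemLp.zero
      add_mem' := fun {f g} hf hg => (memLp_congr_ae (potentialMul_add κ f g)).2 (hf.add hg)
      smul_mem' := fun c f hf => (memLp_congr_ae (potentialMul_smul κ c f)).2 (hf.const_smul c) }
  toFun :=
    { toFun := fun f => MemLp.toLp (potentialMul κ f.1) f.2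
      map_add' := fun f g => by
        rw [← MemLp.toLp_add]
        exact MemLp.toLp_congr _ _ (potentialMul_add κ f.1 g.1)
      map_smul' := fun c f => by
        rw [RingHom.id_apply, ← MemLp.toLp_const_smul]
        exact MemLp.toLp_congr _ _ (potentialMul_smul κ c f.1) }

/-- The integrand of the quadratic form `⟨f, |r|^{-κ} f⟩ = ∫ f(r)† |r|^{-κ} f(r) dr`. -/
def potentialDensity (κ : ℝ) (f : Hrel) (r : R3) : ℝ :=
  (inner ℂ (f r) (potentialMul κ f r)).re

/-- `M_κ = 2^{-κ} Γ(3/4 - κ/2) / Γ(3/4 + κ/2)`. -/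
def herbstConst (κ : ℝ) : ℝ :=
  2 ^ (-κ) * (Real.Gamma (3 / 4 - κ / 2) / Real.Gamma (3 / 4 + κ / 2))

end TwoBodyDirac

end

noncomputable section

namespace TwoBodyDirac

/-! ### Matrix algebra of the symbols -/

/-! The matrix part reduces to a scalar inequality. Write `a` for `α·p`, so `a² = |p|²`. Then `(a⊗1
- 1⊗a)² = 4|p|² P₊(p)`, and `M⁻·p` is unchanged by multiplication with `P₊(p)` on either side. Since
`β` anticommutes with `a`, the matrix `B` anticommutes with `M⁻·p` and commutes with `P₊(p)`. The
cross terms in `A₀(p)†A₀(p)` therefore cancel and leave `4(|p|² + 1) P₊(p)`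
(`star_A0Symbol_mul_A0Symbol`). By uniqueness of positive square roots, `|A₀(p)| = 2(|p|² + 1)^{1/2}
P₊(p)` (`absA0Symbol_eq`). On `Hplus` the projection acts as the identity, so `‖A₀f‖² = 4⟨f,(p̂² +
1)f⟩`, and `|A₀|` is a scalar multiplier comparable to the `H¹` weight.

What remains is the Herbst inequality `herbst`, that is `‖|x|^{-θ/2}f‖ ≤ M_{θ/2} ‖|p̂|^{θ/2}f‖` for
`0 < θ < 3`, together with `|p|^{2κ} ≤ |p|² + 1` for `κ ≤ 1`. The operator bound uses `θ = 2κ`, the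
form bound `θ = κ`.

To prove `herbst`, write `|x|^{-θ}` as a superposition of Gaussians. On the Fourier side each
Gaussian becomes a heat kernel, and their superposition is a Riesz kernel, a multiple of
`|ξ-η|^{θ-3}`. The resulting bilinear form in the norms of `𝓕 f` is bounded by a Schur test
(`schur_test`) whose weight is another Riesz kernel. Riesz kernels convolve explicitly, by the heat
semigroup law and the Beta integral, and the quotient in the test is exactly `M_{θ/2}² |2πξ|^θ`
(`riesz_ratio_eq`). Truncation in momentum and Fatou's lemma pass from integrable transforms to all
of `L²`. -/

theorem pauli_isHermitian (k : Fin 3) : (pauli k).IsHermitian := by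
  ext i j
  fin_cases k <;> fin_cases i <;> fin_cases j <;> simp [pauli]

theorem alpha_isHermitian (k : Fin 3) : (alpha k).IsHermitian := by
  have h : (Matrix.fromBlocks 0 (pauli k) (pauli k) 0).IsHermitian :=
    Matrix.IsHermitian.fromBlocks Matrix.isHermitian_zero (pauli_isHermitian k)
      Matrix.isHermitian_zero
  exact h.submatrix _

theorem beta_isHermitian : beta.IsHermitian := by
  have h : (Matrix.fromBlocks (1 : Matrix (Fin 2) (Fin 2) ℂ) 0 0
      (-1 : Matrix (Fin 2) (Fin 2) ℂ)).IsHermitian :=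
    Matrix.IsHermitian.fromBlocks Matrix.isHermitian_one (by simp) Matrix.isHermitian_one.neg
  exact h.submatrix _

theorem beta_mul_beta : beta * beta = 1 := by
  simp [beta, Matrix.submatrix_mul_equiv, Matrix.fromBlocks_multiply]

theorem beta_mul_alpha (k : Fin 3) : beta * alpha k = -(alpha k * beta) := by
  simp only [beta, alpha, Matrix.reindex_apply, Matrix.submatrix_mul_equiv,
    Matrix.fromBlocks_multiply]
  have h : ∀ A : Matrix (Fin 2 ⊕ Fin 2) (Fin 2 ⊕ Fin 2) ℂ,
      -A.submatrix finSumFinEquiv.symm finSumFinEquiv.symm =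
        (-A).submatrix finSumFinEquiv.symm finSumFinEquiv.symm := fun _ => rfl
  rw [h, Matrix.fromBlocks_neg]
  simp

theorem alphaDot_isHermitian (p : R3) : (alphaDot p).IsHermitian := by
  unfold alphaDot Matrix.IsHermitian
  simp [Matrix.conjTranspose_sum, (alpha_isHermitian _).eq]

theorem beta_mul_alphaDot (p : R3) : beta * alphaDot p = -(alphaDot p * beta) := by
  simp [alphaDot, Finset.mul_sum, Finset.sum_mul, beta_mul_alpha]

theorem alphaDot_mul_alphaDot (p : R3) : alphaDot p * alphaDot p = ((‖p‖ ^ 2 : ℝ) : ℂ) • 1 := by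
  -- In block form `α·p` is off-diagonal with entries `σ·p`, so the claim reduces to `(σ·p)² = |p|²`
  -- for `2×2` matrices.
  have h : alphaDot p = Matrix.reindex finSumFinEquiv finSumFinEquiv
      (Matrix.fromBlocks 0 (∑ k, (p k : ℂ) • pauli k) (∑ k, (p k : ℂ) • pauli k) 0) := by
    ext i j
    obtain ⟨i, rfl⟩ := (finSumFinEquiv (m := 2) (n := 2)).surjective i
    obtain ⟨j, rfl⟩ := (finSumFinEquiv (m := 2) (n := 2)).surjective j
    rcases i with i | i <;> rcases j with j | j <;>
      simp only [alphaDot, alpha, Matrix.reindex_apply, Matrix.sum_apply, Matrix.smul_apply,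
        Matrix.submatrix_apply, Equiv.symm_apply_apply, Matrix.fromBlocks_apply₁₁,
        Matrix.fromBlocks_apply₁₂, Matrix.fromBlocks_apply₂₁, Matrix.fromBlocks_apply₂₂,
        Matrix.zero_apply, smul_zero, Finset.sum_const_zero]
  have h2 : (∑ k, (p k : ℂ) • pauli k) * (∑ k, (p k : ℂ) • pauli k)
      = ((‖p‖ ^ 2 : ℝ) : ℂ) • 1 := by
    rw [EuclideanSpace.norm_sq_eq]
    ext i j
    fin_cases i <;> fin_cases j <;>
      simp [pauli, Fin.sum_univ_three, Matrix.mul_apply] <;> ring_nf <;> simp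
  rw [h, Matrix.reindex_apply, Matrix.submatrix_mul_equiv, Matrix.fromBlocks_multiply]
  simp only [zero_mul, mul_zero, zero_add, add_zero, h2]
  have h3 : Matrix.fromBlocks (((‖p‖ ^ 2 : ℝ) : ℂ) • (1 : Matrix (Fin 2) (Fin 2) ℂ)) 0 0
      (((‖p‖ ^ 2 : ℝ) : ℂ) • (1 : Matrix (Fin 2) (Fin 2) ℂ)) = ((‖p‖ ^ 2 : ℝ) : ℂ) • 1 := by
    rw [← Matrix.fromBlocks_one, Matrix.fromBlocks_smul]; simp only [smul_zero]
  rw [h3, ← Matrix.submatrix_one_equiv (finSumFinEquiv (m := 2) (n := 2)).symm]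
  rfl

theorem tauSymbol_isHermitian (p : R3) : (tauSymbol p).IsHermitian := by
  unfold tauSymbol Matrix.IsHermitian
  rw [Matrix.conjTranspose_smul, Matrix.conjTranspose_kronecker, (alphaDot_isHermitian p).eq]
  simp

/-- The origin must be excluded: with `0⁻¹ = 0` the symbol `tauSymbol 0` vanishes and `PplusSymbol
0` is half the identity. A single momentum is a null set, so later uses hold almost everywhere. -/
theorem tauSymbol_mul_tauSymbol {p : R3} (hp : p ≠ 0) : tauSymbol p * tauSymbol p = 1 := by
  have h : (‖p‖ : ℂ) ≠ 0 := by simpa using hp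
  simp only [tauSymbol, Matrix.smul_mul, Matrix.mul_smul, ← Matrix.mul_kronecker_mul,
    alphaDot_mul_alphaDot, Matrix.smul_kronecker, Matrix.kronecker_smul, smul_smul,
    Matrix.one_kronecker_one]
  convert one_smul ℂ _
  push_cast
  field_simp

theorem PplusSymbol_isHermitian (p : R3) : (PplusSymbol p).IsHermitian := by
  unfold PplusSymbol Matrix.IsHermitian
  rw [Matrix.conjTranspose_smul, Matrix.conjTranspose_add, (tauSymbol_isHermitian p).eq]
  simp

theorem PplusSymbol_mul_PplusSymbol {p : R3} (hp : p ≠ 0) :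
    PplusSymbol p * PplusSymbol p = PplusSymbol p := by
  simp only [PplusSymbol, Matrix.smul_mul, Matrix.mul_smul, add_mul, mul_add,
    tauSymbol_mul_tauSymbol hp, one_mul, mul_one]
  module

theorem MminusDot_eq (p : R3) : MminusDot p =
    alphaDot p ⊗ₖ (1 : Matrix (Fin 4) (Fin 4) ℂ) - (1 : Matrix (Fin 4) (Fin 4) ℂ) ⊗ₖ alphaDot p := by
  ext i j
  simp [MminusDot, Mminus, alphaDot, Matrix.sum_apply, Finset.sum_mul, Finset.mul_sum,
    Matrix.kroneckerMap_apply, mul_sub, mul_assoc, mul_left_comm]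

theorem MminusDot_isHermitian (p : R3) : (MminusDot p).IsHermitian := by
  unfold Matrix.IsHermitian
  rw [MminusDot_eq, Matrix.conjTranspose_sub, Matrix.conjTranspose_kronecker,
    Matrix.conjTranspose_kronecker, (alphaDot_isHermitian p).eq, Matrix.conjTranspose_one]

theorem B_isHermitian : B.IsHermitian := by
  unfold B Matrix.IsHermitian
  rw [Matrix.conjTranspose_smul, Matrix.conjTranspose_kronecker, beta_isHermitian.eq]
  simp

theorem B_mul_B : B * B = (4 : ℂ) • 1 := by
  simp only [B, Matrix.smul_mul, Matrix.mul_smul, ← Matrix.mul_kronecker_mul, beta_mul_beta,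
    Matrix.one_kronecker_one, smul_smul]
  norm_num

theorem kronecker_neg' (M N : Matrix (Fin 4) (Fin 4) ℂ) : M ⊗ₖ (-N) = -(M ⊗ₖ N) := by
  ext; simp [Matrix.kroneckerMap_apply]

theorem neg_kronecker' (M N : Matrix (Fin 4) (Fin 4) ℂ) : (-M) ⊗ₖ N = -(M ⊗ₖ N) := by
  ext; simp [Matrix.kroneckerMap_apply]

/-- Each tensor factor contributes one sign when `β` passes `α·p`, and the two signs cancel. In
`M⁻·p` only one factor carries `α·p`, which is why `B_mul_MminusDot` keeps the sign. -/
theorem B_mul_tauSymbol (p : R3) : B * tauSymbol p = tauSymbol p * B := by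
  simp only [B, tauSymbol, Matrix.smul_mul, Matrix.mul_smul, ← Matrix.mul_kronecker_mul,
    beta_mul_alphaDot, kronecker_neg', neg_kronecker', neg_neg]
  rw [smul_comm]

theorem B_mul_PplusSymbol (p : R3) : B * PplusSymbol p = PplusSymbol p * B := by
  simp only [PplusSymbol, Matrix.mul_smul, Matrix.smul_mul, mul_add, add_mul, B_mul_tauSymbol,
    mul_one, one_mul]

theorem B_mul_MminusDot (p : R3) : B * MminusDot p = -(MminusDot p * B) := by
  simp only [B, MminusDot_eq, Matrix.smul_mul, Matrix.mul_smul, mul_sub, sub_mul,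
    ← Matrix.mul_kronecker_mul, beta_mul_alphaDot, kronecker_neg', neg_kronecker', one_mul, mul_one]
  module

/-- Multiplication by `a⊗a`, with `a = α·p`, turns `a⊗1` into `|p|² 1⊗a` and conversely. Thus `τ`
exchanges the two terms of `M⁻·p`, and its minus sign restores their difference. -/
theorem tauSymbol_mul_MminusDot {p : R3} (hp : p ≠ 0) : tauSymbol p * MminusDot p = MminusDot p := by
  have h : (‖p‖ : ℂ) ≠ 0 := by simpa using hp
  simp only [tauSymbol, MminusDot_eq, Matrix.smul_mul, mul_sub, ← Matrix.mul_kronecker_mul,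
    alphaDot_mul_alphaDot, mul_one, Matrix.smul_kronecker, Matrix.kronecker_smul, ← smul_sub,
    smul_smul]
  rw [← neg_sub (alphaDot p ⊗ₖ (1 : Matrix (Fin 4) (Fin 4) ℂ)), smul_neg, ← neg_smul]
  convert one_smul ℂ _
  push_cast
  field_simp

theorem MminusDot_mul_tauSymbol {p : R3} (hp : p ≠ 0) : MminusDot p * tauSymbol p = MminusDot p := by
  have h := congrArg Matrix.conjTranspose (tauSymbol_mul_MminusDot hp)
  rwa [Matrix.conjTranspose_mul, (tauSymbol_isHermitian p).eq, (MminusDot_isHermitian p).eq] at h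

theorem PplusSymbol_mul_MminusDot {p : R3} (hp : p ≠ 0) :
    PplusSymbol p * MminusDot p = MminusDot p := by
  simp only [PplusSymbol, Matrix.smul_mul, add_mul, one_mul, tauSymbol_mul_MminusDot hp]
  module

theorem MminusDot_mul_PplusSymbol {p : R3} (hp : p ≠ 0) :
    MminusDot p * PplusSymbol p = MminusDot p := by
  simp only [PplusSymbol, Matrix.mul_smul, mul_add, mul_one, MminusDot_mul_tauSymbol hp]
  module

theorem MminusDot_mul_MminusDot {p : R3} (hp : p ≠ 0) :
    MminusDot p * MminusDot p = ((4 * ‖p‖ ^ 2 : ℝ) : ℂ) • PplusSymbol p := by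
  have h : (‖p‖ : ℂ) ≠ 0 := by simpa using hp
  simp only [PplusSymbol, tauSymbol, MminusDot_eq, sub_mul, mul_sub, ← Matrix.mul_kronecker_mul,
    alphaDot_mul_alphaDot, mul_one, one_mul, Matrix.smul_kronecker, Matrix.kronecker_smul,
    smul_add, smul_smul, Matrix.one_kronecker_one]
  have h2 : ((4 * ‖p‖ ^ 2 : ℝ) : ℂ) * (1 / 2 * -(((‖p‖ ^ 2)⁻¹ : ℝ) : ℂ)) = -2 := by
    push_cast
    field_simp
    norm_num
  have h3 : ((4 * ‖p‖ ^ 2 : ℝ) : ℂ) * (1 / 2) = ((‖p‖ ^ 2 : ℝ) : ℂ) + ((‖p‖ ^ 2 : ℝ) : ℂ) := by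
    push_cast
    ring
  rw [h2, h3]
  module

theorem star_A0Symbol_mul_A0Symbol {p : R3} (hp : p ≠ 0) :
    star (A0Symbol p) * A0Symbol p = ((4 * (‖p‖ ^ 2 + 1) : ℝ) : ℂ) • PplusSymbol p := by
  have h1 : star (A0Symbol p) = A0Symbol p := by
    rw [Matrix.star_eq_conjTranspose, A0Symbol, Matrix.conjTranspose_add,
      Matrix.conjTranspose_mul, (MminusDot_isHermitian p).eq, B_isHermitian.eq,
      (PplusSymbol_isHermitian p).eq, B_mul_PplusSymbol]
  -- The projection is absorbed by `M⁻·p` after moving it past `B`. The opposite cross term `h3` is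
  -- the negative of this one.
  have h2 : MminusDot p * (B * PplusSymbol p) = MminusDot p * B := by
    rw [← mul_assoc, ← neg_neg (MminusDot p * B), ← B_mul_MminusDot, neg_mul, mul_assoc,
      MminusDot_mul_PplusSymbol hp]
  have h3 : B * PplusSymbol p * MminusDot p = -(MminusDot p * B) := by
    rw [mul_assoc, PplusSymbol_mul_MminusDot hp, B_mul_MminusDot]
  have h4 : B * PplusSymbol p * (B * PplusSymbol p) = (4 : ℂ) • PplusSymbol p := by
    rw [mul_assoc, ← mul_assoc (PplusSymbol p), ← B_mul_PplusSymbol, mul_assoc B, ← mul_assoc B,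
      B_mul_B, PplusSymbol_mul_PplusSymbol hp, Matrix.smul_mul, one_mul]
  rw [h1, A0Symbol, add_mul, mul_add, mul_add, h2, h3, h4, MminusDot_mul_MminusDot hp]
  push_cast
  module

open scoped MatrixOrder in
theorem PplusSymbol_nonneg {p : R3} (hp : p ≠ 0) : 0 ≤ PplusSymbol p := by
  have h : PplusSymbol p = star (PplusSymbol p) * PplusSymbol p := by
    rw [Matrix.star_eq_conjTranspose, (PplusSymbol_isHermitian p).eq,
      PplusSymbol_mul_PplusSymbol hp]
  rw [h]
  exact star_mul_self_nonneg _

open scoped MatrixOrder ComplexOrder in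
theorem absA0Symbol_eq {p : R3} (hp : p ≠ 0) :
    absA0Symbol p = ((2 * Real.sqrt (‖p‖ ^ 2 + 1) : ℝ) : ℂ) • PplusSymbol p := by
  unfold absA0Symbol CFC.abs
  refine CFC.sqrt_unique ?_ ?_
  · rw [star_A0Symbol_mul_A0Symbol hp, Matrix.smul_mul, Matrix.mul_smul,
      PplusSymbol_mul_PplusSymbol hp, smul_smul, ← Complex.ofReal_mul]
    congr 2
    nlinarith [Real.mul_self_sqrt (show 0 ≤ ‖p‖ ^ 2 + 1 by positivity)]
  · refine smul_nonneg ?_ (PplusSymbol_nonneg hp)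
    rw [Complex.zero_le_real]
    positivity

/-! ### Heat kernels and Riesz kernels -/

theorem lintegral_rpow_mul_exp_neg_mul {a r : ℝ} (ha : 0 < a) (hr : 0 < r) :
    ∫⁻ t in Set.Ioi (0 : ℝ), ENNReal.ofReal (t ^ (a - 1) * Real.exp (-(r * t))) =
      ENNReal.ofReal ((1 / r) ^ a * Real.Gamma a) := by
  rw [← Real.integral_rpow_mul_exp_neg_mul_Ioi ha hr, ofReal_integral_eq_lintegral_ofReal]
  · have h := integrableOn_rpow_mul_exp_neg_mul_rpow (s := a - 1) (p := 1) (by linarith) one_pos hr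
    simpa [neg_mul, IntegrableOn] using h
  · filter_upwards [self_mem_ae_restrict measurableSet_Ioi] with t ht
    have : (0 : ℝ) < t := ht
    simp only [Pi.zero_apply]
    positivity

/-- The Beta integral is read off from the fact that the Beta density has total mass one. -/
theorem lintegral_rpow_mul_one_sub_rpow {α β : ℝ} (hα : 0 < α) (hβ : 0 < β) :
    ∫⁻ s in Set.Ioo (0 : ℝ) 1, ENNReal.ofReal (s ^ (α - 1)) * ENNReal.ofReal ((1 - s) ^ (β - 1)) =
      ENNReal.ofReal (ProbabilityTheory.beta α β) := by
  have h := ProbabilityTheory.lintegral_betaPDF_eq_one hα hβ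
  have hB := ProbabilityTheory.beta_pos hα hβ
  rw [ProbabilityTheory.lintegral_betaPDF] at h
  have h2 : ∫⁻ x in Set.Ioo (0 : ℝ) 1, ENNReal.ofReal
      (1 / ProbabilityTheory.beta α β * x ^ (α - 1) * (1 - x) ^ (β - 1)) =
      ENNReal.ofReal (1 / ProbabilityTheory.beta α β) * ∫⁻ s in Set.Ioo (0 : ℝ) 1,
        ENNReal.ofReal (s ^ (α - 1)) * ENNReal.ofReal ((1 - s) ^ (β - 1)) := by
    rw [← lintegral_const_mul _ (by fun_prop)]
    refine setLIntegral_congr_fun measurableSet_Ioo fun x hx => ?_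
    have := hx.1
    rw [ENNReal.ofReal_mul (by positivity), ENNReal.ofReal_mul (by positivity), mul_assoc]
  rw [h2] at h
  have h3 := congrArg (fun x => ENNReal.ofReal (ProbabilityTheory.beta α β) * x) h
  simp only [mul_one, ← mul_assoc] at h3
  rw [← ENNReal.ofReal_mul hB.le, mul_one_div_cancel hB.ne', ENNReal.ofReal_one, one_mul] at h3
  exact h3

theorem lintegral_Ioo_rpow_mul_sub_rpow {α β w : ℝ} (hα : 0 < α) (hβ : 0 < β) (hw : 0 < w) :
    ∫⁻ u in Set.Ioo 0 w, ENNReal.ofReal (u ^ (α - 1)) * ENNReal.ofReal ((w - u) ^ (β - 1)) =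
      ENNReal.ofReal (ProbabilityTheory.beta α β) * ENNReal.ofReal (w ^ (α + β - 1)) := by
  have him : (fun s => w * s) '' Set.Ioo 0 1 = Set.Ioo 0 w := by
    rw [Set.image_mul_left_Ioo hw]; simp
  rw [← him, lintegral_image_eq_lintegral_abs_deriv_mul measurableSet_Ioo (f' := fun _ => w)
    (fun s _ => by simpa using ((hasDerivAt_id s).const_mul w).hasDerivWithinAt)
    (fun a _ b _ h => mul_left_cancel₀ hw.ne' h), mul_comm,
    ← lintegral_rpow_mul_one_sub_rpow hα hβ, ← lintegral_const_mul _ (by fun_prop)]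
  refine setLIntegral_congr_fun measurableSet_Ioo fun s hs => ?_
  have h0 := hs.1
  have h1 : 0 < 1 - s := by linarith [hs.2]
  rw [← ENNReal.ofReal_mul (by positivity), ← ENNReal.ofReal_mul (by positivity),
    ← ENNReal.ofReal_mul (by positivity), ← ENNReal.ofReal_mul (by positivity)]
  rw [show w - w * s = w * (1 - s) by ring, Real.mul_rpow hw.le h0.le, Real.mul_rpow hw.le h1.le,
    abs_of_pos hw, show α + β - 1 = 1 + (α - 1) + (β - 1) by ring, Real.rpow_add hw,
    Real.rpow_add hw, Real.rpow_one]
  ring_nf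

/-- Substitute `w = u + v` and integrate over `0 < u < w` first; the inner integral is a scaled Beta
integral. This turns the semigroup law of the heat kernels into a composition law for Riesz kernels.
-/
theorem lintegral_lintegral_rpow_mul_rpow_comp_add {α β : ℝ} (hα : 0 < α) (hβ : 0 < β)
    {h : ℝ → ℝ≥0∞} (hh : Measurable h) :
    ∫⁻ u in Set.Ioi (0 : ℝ), ∫⁻ v in Set.Ioi (0 : ℝ),
      ENNReal.ofReal (u ^ (α - 1)) * ENNReal.ofReal (v ^ (β - 1)) * h (u + v) =
    ENNReal.ofReal (ProbabilityTheory.beta α β) *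
      ∫⁻ w in Set.Ioi (0 : ℝ), ENNReal.ofReal (w ^ (α + β - 1)) * h w := by
  have h1 : ∀ u ∈ Set.Ioi (0 : ℝ), ∫⁻ v in Set.Ioi (0 : ℝ),
      ENNReal.ofReal (u ^ (α - 1)) * ENNReal.ofReal (v ^ (β - 1)) * h (u + v) =
      ∫⁻ w in Set.Ioi (0 : ℝ), (Set.Iio w).indicator (fun u =>
        ENNReal.ofReal (u ^ (α - 1)) * ENNReal.ofReal ((w - u) ^ (β - 1))) u * h w := by
    intro u hu
    have him : (fun v => u + v) '' Set.Ioi 0 = Set.Ioi u := by simp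
    have h2 := lintegral_image_eq_lintegral_abs_deriv_mul (s := Set.Ioi (0 : ℝ))
      (f := fun v => u + v) measurableSet_Ioi (f' := fun _ => 1)
      (fun s _ => ((hasDerivAt_id s).const_add u).hasDerivWithinAt)
      (fun a _ b _ h => add_left_cancel h) (fun w => ENNReal.ofReal (u ^ (α - 1)) *
        ENNReal.ofReal ((w - u) ^ (β - 1)) * h w)
    rw [him] at h2
    simp only [abs_one, ENNReal.ofReal_one, one_mul, add_sub_cancel_left] at h2
    rw [← h2, ← lintegral_indicator measurableSet_Ioi, ← lintegral_indicator measurableSet_Ioi]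
    refine lintegral_congr fun w => ?_
    have hu' : 0 < u := hu
    by_cases hw : u < w
    · simp [Set.indicator, hw, hu'.trans hw]
    · simp [Set.indicator, hw]
  rw [setLIntegral_congr_fun measurableSet_Ioi h1, lintegral_lintegral_swap]
  · rw [← lintegral_const_mul _ (by fun_prop)]
    refine setLIntegral_congr_fun measurableSet_Ioi fun w hw => ?_
    rw [lintegral_mul_const _ ((by fun_prop : Measurable fun u : ℝ => ENNReal.ofReal (u ^ (α - 1)) *
      ENNReal.ofReal ((w - u) ^ (β - 1))).indicator measurableSet_Iio),
      lintegral_indicator measurableSet_Iio, Measure.restrict_restrict measurableSet_Iio,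
      Set.inter_comm, Set.Ioi_inter_Iio, lintegral_Ioo_rpow_mul_sub_rpow hα hβ hw, mul_assoc]
  · have hm : Measurable fun x : ℝ × ℝ => {x : ℝ × ℝ | x.1 < x.2}.indicator (fun x =>
        ENNReal.ofReal (x.1 ^ (α - 1)) * ENNReal.ofReal ((x.2 - x.1) ^ (β - 1))) x * h x.2 :=
      (Measurable.indicator (by fun_prop) (measurableSet_lt measurable_fst measurable_snd)).mul
        (by fun_prop)
    exact hm.aemeasurable

/-- The heat kernel on `ℝ³`, normalised as the Fourier transform of `exp (-π u |x|²)`. -/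
def heatKernel (u : ℝ) (q : R3) : ℝ := u ^ (-(3 / 2) : ℝ) * Real.exp (-Real.pi * ‖q‖ ^ 2 / u)

@[fun_prop]
theorem measurable_heatKernel : Measurable fun x : ℝ × R3 => heatKernel x.1 x.2 := by
  unfold heatKernel; fun_prop

theorem heatKernel_nonneg {u : ℝ} (hu : 0 < u) (q : R3) : 0 ≤ heatKernel u q := by
  unfold heatKernel; positivity

theorem lintegral_exp_neg_mul_sq_norm {b : ℝ} (hb : 0 < b) :
    ∫⁻ v : R3, ENNReal.ofReal (Real.exp (-b * ‖v‖ ^ 2)) =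
      ENNReal.ofReal ((Real.pi / b) ^ (3 / 2 : ℝ)) := by
  have h := GaussianFourier.integral_rexp_neg_mul_sq_norm (V := R3) hb
  have hi : Integrable fun v : R3 => Real.exp (-b * ‖v‖ ^ 2) := by
    -- A non-integrable function would have Bochner integral zero, whereas the Gaussian formula
    -- gives a positive value.
    by_contra hc
    rw [integral_undef hc] at h
    have : 0 < (Real.pi / b) ^ ((Module.finrank ℝ R3 : ℝ) / 2) := by positivity
    exact this.ne h
  rw [← ofReal_integral_eq_lintegral_ofReal hi (by filter_upwards with v; positivity), h]
  simp

/-- Completing the square centres the product at `(v/(u+v)) ξ`; a translated Gaussian integral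
remains. -/
theorem lintegral_heatKernel_mul_heatKernel {u v : ℝ} (hu : 0 < u) (hv : 0 < v) (ξ : R3) :
    ∫⁻ η, ENNReal.ofReal (heatKernel u (ξ - η)) * ENNReal.ofReal (heatKernel v η) =
      ENNReal.ofReal (heatKernel (u + v) ξ) := by
  have hb : 0 < Real.pi * (u + v) / (u * v) := by positivity
  have key : ∀ η : R3, ENNReal.ofReal (heatKernel u (ξ - η)) * ENNReal.ofReal (heatKernel v η) =
      ENNReal.ofReal ((u * v) ^ (-(3 / 2) : ℝ) * Real.exp (-Real.pi * ‖ξ‖ ^ 2 / (u + v))) *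
      ENNReal.ofReal (Real.exp (-(Real.pi * (u + v) / (u * v)) * ‖η - (v / (u + v)) • ξ‖ ^ 2)) := by
    intro η
    rw [← ENNReal.ofReal_mul (heatKernel_nonneg hu _), ← ENNReal.ofReal_mul (by positivity)]
    congr 1
    unfold heatKernel
    rw [Real.mul_rpow hu.le hv.le, mul_mul_mul_comm, mul_assoc (_ * _) (Real.exp _) (Real.exp _),
      ← Real.exp_add, ← Real.exp_add]
    congr 2
    rw [norm_sub_sq_real, norm_sub_sq_real, norm_smul, inner_smul_right, real_inner_comm,
      Real.norm_eq_abs, abs_of_pos (by positivity)]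
    field_simp
    ring
  simp_rw [key]
  rw [lintegral_const_mul _ (by fun_prop),
    lintegral_sub_right_eq_self (fun η : R3 => ENNReal.ofReal
      (Real.exp (-(Real.pi * (u + v) / (u * v)) * ‖η‖ ^ 2))),
    lintegral_exp_neg_mul_sq_norm hb, ← ENNReal.ofReal_mul (by positivity)]
  congr 1
  unfold heatKernel
  rw [mul_right_comm]
  congr 1
  rw [show Real.pi / (Real.pi * (u + v) / (u * v)) = (u * v) * (u + v)⁻¹ by field_simp,
    Real.mul_rpow (y := (u + v)⁻¹) (by positivity) (by positivity), ← mul_assoc,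
    ← Real.rpow_add (by positivity),
    Real.inv_rpow (by positivity), ← Real.rpow_neg (by positivity)]
  simp

/-- The superposition `∫₀^∞ u^{α - 1} H_u du` of heat kernels, a multiple of `|q|^{2α - 3}`. -/
def rieszKernel (α : ℝ) (q : R3) : ℝ≥0∞ :=
  ∫⁻ u in Set.Ioi (0 : ℝ), ENNReal.ofReal (u ^ (α - 1)) * ENNReal.ofReal (heatKernel u q)

@[fun_prop]
theorem measurable_rieszKernel (α : ℝ) : Measurable (rieszKernel α) := by
  unfold rieszKernel
  refine Measurable.lintegral_prod_left' (f := fun x : ℝ × R3 =>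
    ENNReal.ofReal (x.1 ^ (α - 1)) * ENNReal.ofReal (heatKernel x.1 x.2)) ?_
  fun_prop

/-- The substitution `u = 1/t` turns the superposition into a Gamma integral with exponent `3/2 -
α`; convergence requires `α < 3/2`. -/
theorem rieszKernel_eq {α : ℝ} (hα : α < 3 / 2) {q : R3} (hq : q ≠ 0) :
    rieszKernel α q = ENNReal.ofReal
      (Real.Gamma (3 / 2 - α) * (Real.pi * ‖q‖ ^ 2) ^ (α - 3 / 2)) := by
  have hq' : 0 < ‖q‖ := norm_pos_iff.2 hq
  have him : (fun t : ℝ => t⁻¹) '' Set.Ioi 0 = Set.Ioi 0 := by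
    ext x
    refine ⟨?_, fun hx => ⟨x⁻¹, Set.mem_Ioi.2 (inv_pos.2 hx), inv_inv x⟩⟩
    rintro ⟨y, hy, rfl⟩
    exact Set.mem_Ioi.2 (inv_pos.2 hy)
  unfold rieszKernel
  rw [← him, lintegral_image_eq_lintegral_abs_deriv_mul measurableSet_Ioi
    (f' := fun t => -(t ^ 2)⁻¹)
    (fun t ht => (hasDerivAt_inv (ne_of_gt ht)).hasDerivWithinAt)
    (fun a _ b _ h => inv_injective h)]
  have h := lintegral_rpow_mul_exp_neg_mul (a := 3 / 2 - α) (r := Real.pi * ‖q‖ ^ 2)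
    (by linarith) (by positivity)
  rw [one_div, Real.inv_rpow (by positivity), ← Real.rpow_neg (by positivity), neg_sub,
    mul_comm (_ ^ _)] at h
  rw [← h]
  refine setLIntegral_congr_fun measurableSet_Ioi fun t ht => ?_
  have ht' : 0 < t := ht
  have h2 : (0 : ℝ) ≤ heatKernel t⁻¹ q := heatKernel_nonneg (by positivity) _
  rw [← ENNReal.ofReal_mul (by positivity), ← ENNReal.ofReal_mul (by positivity)]
  congr 1
  unfold heatKernel
  rw [abs_neg, abs_of_pos (by positivity), Real.inv_rpow ht'.le, Real.inv_rpow ht'.le,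
    ← Real.rpow_neg ht'.le, ← Real.rpow_neg ht'.le, ← Real.rpow_natCast, ← Real.rpow_neg ht'.le,
    ← mul_assoc, ← mul_assoc, ← Real.rpow_add ht', ← Real.rpow_add ht']
  congr 2
  · push_cast; ring
  · rw [div_inv_eq_mul]; ring

theorem lintegral_rieszKernel_mul_rieszKernel {α β : ℝ} (hα : 0 < α) (hβ : 0 < β) (ξ : R3) :
    ∫⁻ η, rieszKernel α (ξ - η) * rieszKernel β η =
      ENNReal.ofReal (ProbabilityTheory.beta α β) * rieszKernel (α + β) ξ := by
  have h1 : ∀ η, rieszKernel α (ξ - η) * rieszKernel β η =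
      ∫⁻ u in Set.Ioi (0 : ℝ), ∫⁻ v in Set.Ioi (0 : ℝ),
        ENNReal.ofReal (u ^ (α - 1)) * ENNReal.ofReal (v ^ (β - 1)) *
        (ENNReal.ofReal (heatKernel u (ξ - η)) * ENNReal.ofReal (heatKernel v η)) := by
    intro η
    unfold rieszKernel
    rw [← lintegral_mul_const _ (by fun_prop)]
    refine lintegral_congr fun u => ?_
    rw [← lintegral_const_mul _ (by fun_prop)]
    refine lintegral_congr fun v => ?_
    ring
  simp_rw [h1]
  rw [lintegral_lintegral_swap]
  swap
  · exact (Measurable.lintegral_prod_right' (f := fun x : (R3 × ℝ) × ℝ =>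
        ENNReal.ofReal (x.1.2 ^ (α - 1)) * ENNReal.ofReal (x.2 ^ (β - 1)) *
        (ENNReal.ofReal (heatKernel x.1.2 (ξ - x.1.1)) * ENNReal.ofReal (heatKernel x.2 x.1.1)))
        (by fun_prop)).aemeasurable
  unfold rieszKernel
  rw [← lintegral_lintegral_rpow_mul_rpow_comp_add hα hβ
    (h := fun w => ENNReal.ofReal (heatKernel w ξ)) (by fun_prop)]
  refine setLIntegral_congr_fun measurableSet_Ioi fun u hu => ?_
  rw [lintegral_lintegral_swap (by fun_prop)]
  refine setLIntegral_congr_fun measurableSet_Ioi fun v hv => ?_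
  rw [lintegral_const_mul _ (by fun_prop), lintegral_heatKernel_mul_heatKernel hu hv]

/-! ### The inverse Fourier transform of integrable functions in `L²` -/

theorem continuous_fourierInv {g : R3 → Spinor} (hg : Integrable g) : Continuous (𝓕⁻ g) :=
  VectorFourier.fourierIntegral_continuous Real.continuous_fourierChar
    (L := -innerₗ R3) (continuous_inner (𝕜 := ℝ) (E := R3)).neg hg

theorem norm_fourierInv_le {g : R3 → Spinor} (x : R3) : ‖𝓕⁻ g x‖ ≤ ∫ ξ, ‖g ξ‖ :=
  VectorFourier.norm_fourierIntegral_le_integral_norm _ _ _ _ _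

theorem integral_fourierInv_smul {k : R3 → ℂ} {g : R3 → Spinor} (hk : Integrable k)
    (hg : Integrable g) : ∫ η, 𝓕⁻ k η • g η = ∫ x, k x • 𝓕⁻ g x := by
  have h := VectorFourier.integral_fourierIntegral_smul_eq_flip (L := -innerₗ R3)
    (μ := volume) (ν := volume)
    Real.continuous_fourierChar (continuous_inner (𝕜 := ℝ) (E := R3)).neg hk hg
  have hflip : (-innerₗ R3).flip = -innerₗ R3 := by
    ext x y
    simp [real_inner_comm]
  rw [hflip] at h
  exact h

theorem integral_inner_fourier {a b : R3 → Spinor} (ha : Integrable a) (hb : Integrable b) :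
    ∫ ξ, inner ℂ (𝓕 a ξ) (b ξ) = ∫ x, inner ℂ (a x) (𝓕⁻ b x) := by
  have h := VectorFourier.integral_sesq_fourierIntegral_eq_neg_flip (L := innerₗ R3)
    (μ := volume) (ν := volume) (innerSL ℂ)
    Real.continuous_fourierChar (by simpa using continuous_inner) ha hb
  have hflip : -(innerₗ R3).flip = -innerₗ R3 := by
    ext x y
    simp
  rw [hflip] at h
  exact h

/-- The `L²` transform is accessible through tempered distributions, the pointwise one through its
integral. Against a test function both move onto that function and give the same number, so they
agree almost everywhere. -/
theorem coeFn_fourierInv_ae_eq {g : Hrel} (hg : Integrable g) :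
    (𝓕⁻ g : Hrel) =ᵐ[volume] 𝓕⁻ (g : R3 → Spinor) := by
  refine ae_eq_of_integral_contDiff_smul_eq ((Lp.memLp _).locallyIntegrable one_le_two)
    (continuous_fourierInv hg).locallyIntegrable fun φ hφ hφc => ?_
  have h1 : HasCompactSupport (Complex.ofRealCLM ∘ φ) := hφc.comp_left rfl
  have h2 : ContDiff ℝ (⊤ : ℕ∞) (Complex.ofRealCLM ∘ φ) :=
    Complex.ofRealCLM.contDiff.comp hφ
  set ψ := h1.toSchwartzMap h2 with hψ
  have h3 : ∫ x, ψ x • (𝓕⁻ g : Hrel) x = ∫ x, (𝓕⁻ ψ : SchwartzMap R3 ℂ) x • g x := by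
    rw [← Lp.toTemperedDistribution_apply, ← Lp.fourierInv_toTemperedDistribution_eq,
      TemperedDistribution.fourierInv_apply, Lp.toTemperedDistribution_apply]
  rw [SchwartzMap.fourierInv_coe, integral_fourierInv_smul ψ.integrable hg] at h3
  simpa [hψ] using h3

theorem fourierInv_gaussian {t : ℝ} (ht : 0 < t) (ξ η : R3) :
    ‖𝓕⁻ (fun x : R3 => Complex.exp (-((Real.pi * t : ℝ) : ℂ) * ‖x‖ ^ 2 +
      2 * Real.pi * Complex.I * inner ℝ (-ξ) x)) η‖ₑ = ENNReal.ofReal (heatKernel t (ξ - η)) := by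
  rw [Real.fourierInv_eq_fourier_neg, fourier_gaussian_innerProductSpace'
    (by simpa using mul_pos Real.pi_pos ht), ← ofReal_norm]
  congr 1
  rw [norm_mul, Complex.norm_exp]
  unfold heatKernel
  have h1 : (Real.pi : ℂ) / ((Real.pi * t : ℝ) : ℂ) = ((t⁻¹ : ℝ) : ℂ) := by
    have : (Real.pi : ℂ) ≠ 0 := by exact_mod_cast Real.pi_ne_zero
    push_cast
    field_simp
  congr 1
  · rw [h1, Complex.norm_cpow_eq_rpow_re_of_pos (by positivity)]
    simp [Real.inv_rpow ht.le, Real.rpow_neg ht.le]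
  · congr 1
    have h2 : -(Real.pi : ℂ) ^ 2 * ‖-ξ - -η‖ ^ 2 / ((Real.pi * t : ℝ) : ℂ) =
        ((-Real.pi * ‖ξ - η‖ ^ 2 / t : ℝ) : ℂ) := by
      rw [show -ξ - -η = -(ξ - η) by abel, norm_neg]
      have : (Real.pi : ℂ) ≠ 0 := by exact_mod_cast Real.pi_ne_zero
      have : (t : ℂ) ≠ 0 := by exact_mod_cast ht.ne'
      push_cast
      field_simp
    rw [h2, Complex.ofReal_re]

/-- This is the convolution theorem with absolute values. The Gaussian and the character at `ξ` are
merged into one integrable function `k`, and the inverse transform is moved from `g` to `k`. -/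
theorem enorm_fourier_gaussian_smul_fourierInv_le {t : ℝ} (ht : 0 < t) {g : R3 → Spinor}
    (hg : Integrable g) (ξ : R3) :
    ‖𝓕 (fun x => ((Real.exp (-(Real.pi * t * ‖x‖ ^ 2)) : ℝ) : ℂ) • 𝓕⁻ g x) ξ‖ₑ ≤
      ∫⁻ η, ‖g η‖ₑ * ENNReal.ofReal (heatKernel t (ξ - η)) := by
  set k : R3 → ℂ := fun x => Complex.exp (-((Real.pi * t : ℝ) : ℂ) * ‖x‖ ^ 2 +
      2 * Real.pi * Complex.I * inner ℝ (-ξ) x) with hk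
  have hki : Integrable k := GaussianFourier.integrable_cexp_neg_mul_sq_norm_add
    (by simpa using mul_pos Real.pi_pos ht) _ _
  have h1 : 𝓕 (fun x => ((Real.exp (-(Real.pi * t * ‖x‖ ^ 2)) : ℝ) : ℂ) • 𝓕⁻ g x) ξ =
      ∫ x, k x • 𝓕⁻ g x := by
    rw [Real.fourier_eq']
    refine integral_congr_ae (Filter.Eventually.of_forall fun x => ?_)
    simp only [hk, smul_smul]
    congr 1
    rw [Complex.ofReal_exp, ← Complex.exp_add]
    congr 1
    rw [inner_neg_left, real_inner_comm]
    push_cast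
    ring
  rw [h1, ← integral_fourierInv_smul hki hg]
  refine (enorm_integral_le_lintegral_enorm _).trans (lintegral_mono fun η => ?_)
  rw [enorm_smul, fourierInv_gaussian ht, mul_comm]

theorem integrable_gaussian {t : ℝ} (ht : 0 < t) :
    Integrable fun x : R3 => ((Real.exp (-(Real.pi * t * ‖x‖ ^ 2)) : ℝ) : ℂ) := by
  have h := GaussianFourier.integrable_cexp_neg_mul_sq_norm_add (V := R3)
    (b := ((Real.pi * t : ℝ) : ℂ)) (by simpa using mul_pos Real.pi_pos ht) 0 0
  refine h.congr (Filter.Eventually.of_forall fun x => ?_)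
  simp

/-- The Gaussian makes the bounded function `𝓕⁻ g` integrable, so Parseval applies to its product
with `𝓕⁻ g`. Passing to norms of spinors is harmless because the heat kernel is nonnegative. -/
theorem lintegral_gaussian_mul_enorm_fourierInv_sq_le {t : ℝ} (ht : 0 < t) {g : R3 → Spinor}
    (hg : Integrable g) :
    ∫⁻ x, ENNReal.ofReal (Real.exp (-(Real.pi * t * ‖x‖ ^ 2))) * ‖𝓕⁻ g x‖ₑ ^ 2 ≤
      ∫⁻ ξ, ∫⁻ η, ‖g ξ‖ₑ * ‖g η‖ₑ * ENNReal.ofReal (heatKernel t (ξ - η)) := by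
  set a : R3 → Spinor :=
    fun x => ((Real.exp (-(Real.pi * t * ‖x‖ ^ 2)) : ℝ) : ℂ) • 𝓕⁻ g x with ha
  have hbdd : ∀ᵐ x, ‖𝓕⁻ g x‖ ≤ ∫ ξ, ‖g ξ‖ := Filter.Eventually.of_forall norm_fourierInv_le
  have hai : Integrable a := (integrable_gaussian ht).smul_bdd _
    (continuous_fourierInv hg).aestronglyMeasurable hbdd
  have hpt : ∀ x, inner ℂ (a x) (𝓕⁻ g x) =
      ((Real.exp (-(Real.pi * t * ‖x‖ ^ 2)) * ‖𝓕⁻ g x‖ ^ 2 : ℝ) : ℂ) := by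
    intro x
    simp only [ha]
    rw [inner_smul_left, inner_self_eq_norm_sq_to_K, Complex.conj_ofReal]
    push_cast
    rfl
  have hint : Integrable fun x => Real.exp (-(Real.pi * t * ‖x‖ ^ 2)) * ‖𝓕⁻ g x‖ ^ 2 := by
    have h := hai.norm.mul_bdd (continuous_fourierInv hg).norm.aestronglyMeasurable
      (c := ∫ ξ, ‖g ξ‖) (by simpa using hbdd)
    refine h.congr (Filter.Eventually.of_forall fun x => ?_)
    simp only [ha, norm_smul, Complex.norm_real, Real.norm_eq_abs, Real.abs_exp]
    ring
  have h1 : ∫⁻ x, ENNReal.ofReal (Real.exp (-(Real.pi * t * ‖x‖ ^ 2))) * ‖𝓕⁻ g x‖ₑ ^ 2 =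
      ‖∫ ξ, inner ℂ (𝓕 a ξ) (g ξ)‖ₑ := by
    rw [integral_inner_fourier hai hg]
    simp_rw [hpt]
    rw [integral_complex_ofReal, ← ofReal_norm, Complex.norm_real, Real.norm_eq_abs,
      abs_of_nonneg (integral_nonneg fun x => by positivity),
      ofReal_integral_eq_lintegral_ofReal hint (Filter.Eventually.of_forall fun x => by positivity)]
    refine lintegral_congr fun x => ?_
    rw [ENNReal.ofReal_mul (by positivity), ENNReal.ofReal_pow (by positivity),
      ofReal_norm]
  rw [h1]
  refine (enorm_integral_le_lintegral_enorm _).trans (lintegral_mono fun ξ => ?_)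
  have h2 : ‖(inner ℂ (𝓕 a ξ) (g ξ) : ℂ)‖ₑ ≤ ‖g ξ‖ₑ * ‖𝓕 a ξ‖ₑ := by
    rw [← ofReal_norm, ← ofReal_norm, ← ofReal_norm,
      ← ENNReal.ofReal_mul (by positivity)]
    exact ENNReal.ofReal_le_ofReal ((norm_inner_le_norm _ _).trans (mul_comm _ _).le)
  refine h2.trans ?_
  simp only [mul_assoc]
  rw [lintegral_const_mul' _ _ enorm_ne_top]
  gcongr
  exact enorm_fourier_gaussian_smul_fourierInv_le ht hg ξ

/-! ### The sharp Herbst inequality -/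

theorem two_mul_le_sq_mul_div_add {a b x y : ℝ≥0∞} (ha : a ≠ ∞) (hb : b ≠ ∞) (hx : x ≠ 0)
    (hx' : x ≠ ∞) (hy : y ≠ 0) (hy' : y ≠ ∞) :
    2 * (a * b) ≤ a ^ 2 * (y / x) + b ^ 2 * (x / y) := by
  lift a to NNReal using ha
  lift b to NNReal using hb
  lift x to NNReal using hx'
  lift y to NNReal using hy'
  have hx0 : x ≠ 0 := by exact_mod_cast hx
  have hy0 : y ≠ 0 := by exact_mod_cast hy
  rw [← ENNReal.coe_div hx0, ← ENNReal.coe_div hy0]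
  norm_cast
  rw [← NNReal.coe_le_coe]
  push_cast
  have hx1 : (0 : ℝ) < x := by exact_mod_cast pos_iff_ne_zero.2 hx0
  have hy1 : (0 : ℝ) < y := by exact_mod_cast pos_iff_ne_zero.2 hy0
  have h : (a : ℝ) ^ 2 * (y / x) + b ^ 2 * (x / y) - 2 * (a * b) =
      (a * y - b * x) ^ 2 / (x * y) := by
    field_simp
    ring
  have : 0 ≤ ((a : ℝ) * y - b * x) ^ 2 / (x * y) := by positivity
  linarith

/-- Weighted AM-GM gives `2φ(ξ)φ(η) ≤ φ(ξ)² h(η)/h(ξ) + φ(η)² h(ξ)/h(η)`. Integrated against the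
even kernel, the two terms coincide. The weight may be singular at the origin, as Riesz kernels are.
-/
theorem schur_test {φ h K : R3 → ℝ≥0∞} (hφ : Measurable φ) (hh : Measurable h)
    (hK : Measurable K) (hφ' : ∀ ξ, φ ξ ≠ ∞) (hh0 : ∀ ξ ≠ 0, h ξ ≠ 0) (hh1 : ∀ ξ ≠ 0, h ξ ≠ ∞)
    (hKs : ∀ ξ, K (-ξ) = K ξ) :
    ∫⁻ ξ, ∫⁻ η, φ ξ * φ η * K (ξ - η) ≤ ∫⁻ ξ, φ ξ ^ 2 * ((∫⁻ η, K (ξ - η) * h η) / h ξ) := by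
  have hne : ∀ᵐ ξ : R3, ξ ≠ 0 := by simp [ae_iff]
  have hle : 2 * ∫⁻ ξ, ∫⁻ η, φ ξ * φ η * K (ξ - η) ≤
      (∫⁻ ξ, ∫⁻ η, φ ξ ^ 2 * (h η / h ξ) * K (ξ - η)) +
      ∫⁻ ξ, ∫⁻ η, φ η ^ 2 * (h ξ / h η) * K (ξ - η) := by
    rw [← lintegral_const_mul _ (by fun_prop), ← lintegral_add_left (by fun_prop)]
    refine lintegral_mono_ae ?_
    filter_upwards [hne] with ξ hξ
    rw [← lintegral_const_mul _ (by fun_prop), ← lintegral_add_left (by fun_prop)]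
    refine lintegral_mono_ae ?_
    filter_upwards [hne] with η hη
    rw [← mul_assoc, ← add_mul]
    gcongr
    exact two_mul_le_sq_mul_div_add (hφ' _) (hφ' _) (hh0 ξ hξ) (hh1 ξ hξ) (hh0 η hη) (hh1 η hη)
  have hsymm : ∫⁻ ξ, ∫⁻ η, φ η ^ 2 * (h ξ / h η) * K (ξ - η) =
      ∫⁻ ξ, ∫⁻ η, φ ξ ^ 2 * (h η / h ξ) * K (ξ - η) := by
    rw [lintegral_lintegral_swap (by fun_prop)]
    refine lintegral_congr fun ξ => lintegral_congr fun η => ?_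
    rw [← hKs, neg_sub]
  rw [hsymm, ← two_mul] at hle
  have hle2 := (ENNReal.mul_le_mul_iff_right (by norm_num) (by norm_num)).1 hle
  refine hle2.trans (le_of_eq ?_)
  refine lintegral_congr fun ξ => ?_
  rw [ENNReal.div_eq_inv_mul, ← mul_assoc, ← lintegral_const_mul _ (by fun_prop)]
  refine lintegral_congr fun η => ?_
  rw [ENNReal.div_eq_inv_mul]
  ring

theorem rieszKernel_neg (α : ℝ) (q : R3) : rieszKernel α (-q) = rieszKernel α q := by
  simp [rieszKernel, heatKernel]

theorem ofReal_norm_rpow_neg_eq_lintegral {θ : ℝ} (hθ : 0 < θ) {x : R3} (hx : x ≠ 0) :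
    ENNReal.ofReal (‖x‖ ^ (-θ)) =
      ENNReal.ofReal (Real.pi ^ (θ / 2) / Real.Gamma (θ / 2)) * ∫⁻ t in Set.Ioi (0 : ℝ),
        ENNReal.ofReal (t ^ (θ / 2 - 1)) *
          ENNReal.ofReal (Real.exp (-(Real.pi * t * ‖x‖ ^ 2))) := by
  have hx' : 0 < ‖x‖ := norm_pos_iff.2 hx
  have hΓ := Real.Gamma_pos_of_pos (half_pos hθ)
  have h := lintegral_rpow_mul_exp_neg_mul (a := θ / 2) (r := Real.pi * ‖x‖ ^ 2)
    (by linarith) (by positivity)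
  have h2 : ∫⁻ t in Set.Ioi (0 : ℝ), ENNReal.ofReal (t ^ (θ / 2 - 1)) *
          ENNReal.ofReal (Real.exp (-(Real.pi * t * ‖x‖ ^ 2))) =
      ∫⁻ t in Set.Ioi (0 : ℝ),
        ENNReal.ofReal (t ^ (θ / 2 - 1) * Real.exp (-(Real.pi * ‖x‖ ^ 2 * t))) := by
    refine setLIntegral_congr_fun measurableSet_Ioi fun t ht => ?_
    have ht' : 0 < t := ht
    rw [← ENNReal.ofReal_mul (by positivity), mul_right_comm Real.pi]
  rw [h2, h, ← ENNReal.ofReal_mul (by positivity)]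
  congr 1
  rw [one_div, Real.inv_rpow (by positivity), Real.mul_rpow Real.pi_pos.le (by positivity),
    ← Real.rpow_natCast, ← Real.rpow_mul hx'.le, Real.rpow_neg hx'.le]
  have : ((2 : ℕ) : ℝ) * (θ / 2) = θ := by push_cast; ring
  rw [this]
  field_simp

/-- The weight index `3/4 - θ/4` is the symmetric choice: the Gamma quotient from the Beta function
and the one from the two Riesz kernels are then equal, which produces the square of the Herbst
constant. The weight is a multiple of `|ξ|^{-3/2-θ/2}`, and `θ < 3` keeps every Riesz index in `(0,
3/2)`. -/
theorem riesz_ratio_eq {θ : ℝ} (h0 : 0 < θ) (h3 : θ < 3) {ξ : R3} (hξ : ξ ≠ 0) :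
    ENNReal.ofReal (Real.pi ^ (θ / 2) / Real.Gamma (θ / 2)) *
      ((∫⁻ η, rieszKernel (θ / 2) (ξ - η) * rieszKernel (3 / 4 - θ / 4) η) /
        rieszKernel (3 / 4 - θ / 4) ξ) =
    ENNReal.ofReal (herbstConst (θ / 2) ^ 2) * ENNReal.ofReal (‖(2 * Real.pi) • ξ‖ ^ θ) := by
  have hξ' : 0 < ‖ξ‖ := norm_pos_iff.2 hξ
  have hΓ := Real.Gamma_pos_of_pos (half_pos h0)
  have hΓ1 := Real.Gamma_pos_of_pos (show 0 < 3 / 4 - θ / 4 by linarith)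
  have hΓ2 := Real.Gamma_pos_of_pos (show 0 < 3 / 4 + θ / 4 by linarith)
  rw [lintegral_rieszKernel_mul_rieszKernel (by linarith) (by linarith),
    rieszKernel_eq (by linarith) hξ, rieszKernel_eq (by linarith) hξ]
  have e1 : 3 / 2 - (θ / 2 + (3 / 4 - θ / 4)) = 3 / 4 - θ / 4 := by ring
  have e2 : 3 / 2 - (3 / 4 - θ / 4) = 3 / 4 + θ / 4 := by ring
  have e3 : θ / 2 + (3 / 4 - θ / 4) - 3 / 2 = (3 / 4 - θ / 4 - 3 / 2) + θ / 2 := by ring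
  have e4 : θ / 2 + (3 / 4 - θ / 4) = 3 / 4 + θ / 4 := by ring
  rw [e1, e2, e3, Real.rpow_add (by positivity)]
  have hB := ProbabilityTheory.beta_pos (half_pos h0) (show 0 < 3 / 4 - θ / 4 by linarith)
  rw [← ENNReal.ofReal_mul hB.le, ← ENNReal.ofReal_div_of_pos (by positivity),
    ← ENNReal.ofReal_mul (by positivity), ← ENNReal.ofReal_mul (by positivity)]
  congr 1
  rw [ProbabilityTheory.beta, e4, herbstConst, norm_smul, Real.norm_eq_abs,
    abs_of_pos (by positivity), Real.mul_rpow (by positivity) hξ'.le,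
    Real.mul_rpow (by positivity) Real.pi_pos.le, Real.mul_rpow (z := θ / 2) Real.pi_pos.le (by positivity),
    ← Real.rpow_natCast_mul hξ'.le]
  have e5 : ((2 : ℕ) : ℝ) * (θ / 2) = θ := by push_cast; ring
  have e6 : θ / 2 / 2 = θ / 4 := by ring
  have e7 : (2 : ℝ) ^ θ = (2 ^ (θ / 2)) ^ 2 := by
    rw [← Real.rpow_natCast, ← Real.rpow_mul (by norm_num)]; congr 1; push_cast; ring
  have e8 : Real.pi ^ θ = (Real.pi ^ (θ / 2)) ^ 2 := by
    rw [← Real.rpow_natCast, ← Real.rpow_mul Real.pi_pos.le]; congr 1; push_cast; ring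
  rw [e5, e6, e7, e8, Real.rpow_neg (by norm_num)]
  have hp : (0 : ℝ) < (Real.pi * ‖ξ‖ ^ 2) ^ (3 / 4 - θ / 4 - 3 / 2) := by positivity
  have h2 : (0 : ℝ) < 2 ^ (θ / 2) := by positivity
  field_simp

theorem lintegral_norm_rpow_neg_mul {θ : ℝ} (hθ : 0 < θ) {Φ : R3 → ℝ≥0∞} (hΦ : Measurable Φ) :
    ∫⁻ x, ENNReal.ofReal (‖x‖ ^ (-θ)) * Φ x =
      ENNReal.ofReal (Real.pi ^ (θ / 2) / Real.Gamma (θ / 2)) *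
        ∫⁻ t in Set.Ioi (0 : ℝ), ENNReal.ofReal (t ^ (θ / 2 - 1)) *
          ∫⁻ x, ENNReal.ofReal (Real.exp (-(Real.pi * t * ‖x‖ ^ 2))) * Φ x := by
  have hne : ∀ᵐ ξ : R3, ξ ≠ 0 := by simp [ae_iff]
  have h : ∀ᵐ x : R3, ENNReal.ofReal (‖x‖ ^ (-θ)) * Φ x =
      ENNReal.ofReal (Real.pi ^ (θ / 2) / Real.Gamma (θ / 2)) *
        ∫⁻ t in Set.Ioi (0 : ℝ), ENNReal.ofReal (t ^ (θ / 2 - 1)) *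
          (ENNReal.ofReal (Real.exp (-(Real.pi * t * ‖x‖ ^ 2))) * Φ x) := by
    filter_upwards [hne] with x hx
    rw [ofReal_norm_rpow_neg_eq_lintegral hθ hx, mul_assoc, ← lintegral_mul_const _ (by fun_prop)]
    congr 1
    refine lintegral_congr fun t => ?_
    rw [mul_assoc]
  rw [lintegral_congr_ae h, lintegral_const_mul' _ _ ENNReal.ofReal_ne_top,
    lintegral_lintegral_swap (by fun_prop)]
  congr 1
  refine lintegral_congr fun t => ?_
  rw [lintegral_const_mul _ (by fun_prop)]

theorem lintegral_rpow_mul_lintegral_heatKernel (α : ℝ) {φ : R3 → ℝ≥0∞} (hφ : Measurable φ) :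
    ∫⁻ t in Set.Ioi (0 : ℝ), ENNReal.ofReal (t ^ (α - 1)) *
      (∫⁻ ξ, ∫⁻ η, φ ξ * φ η * ENNReal.ofReal (heatKernel t (ξ - η))) =
      ∫⁻ ξ, ∫⁻ η, φ ξ * φ η * rieszKernel α (ξ - η) := by
  have hmeas : Measurable fun p : (ℝ × R3) × R3 => φ p.1.2 * φ p.2 *
      ENNReal.ofReal (heatKernel p.1.1 (p.1.2 - p.2)) := by fun_prop
  have hmeas2 := hmeas.lintegral_prod_right' (ν := (volume : Measure R3))
  have h1 : ∀ t : ℝ, ENNReal.ofReal (t ^ (α - 1)) *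
      (∫⁻ ξ, ∫⁻ η, φ ξ * φ η * ENNReal.ofReal (heatKernel t (ξ - η))) =
      ∫⁻ ξ, ENNReal.ofReal (t ^ (α - 1)) *
        ∫⁻ η, φ ξ * φ η * ENNReal.ofReal (heatKernel t (ξ - η)) := fun t =>
    (lintegral_const_mul' _ _ ENNReal.ofReal_ne_top).symm
  simp_rw [h1]
  have hmeas3 : Measurable fun p : ℝ × R3 => ENNReal.ofReal (p.1 ^ (α - 1)) *
      ∫⁻ η, φ p.2 * φ η * ENNReal.ofReal (heatKernel p.1 (p.2 - η)) :=
    Measurable.mul (by fun_prop) hmeas2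
  rw [lintegral_lintegral_swap hmeas3.aemeasurable]
  refine lintegral_congr fun ξ => ?_
  have h2 : ∀ t : ℝ, ENNReal.ofReal (t ^ (α - 1)) *
      ∫⁻ η, φ ξ * φ η * ENNReal.ofReal (heatKernel t (ξ - η)) =
      ∫⁻ η, φ ξ * φ η * (ENNReal.ofReal (t ^ (α - 1)) *
        ENNReal.ofReal (heatKernel t (ξ - η))) := by
    intro t
    rw [← lintegral_const_mul' _ _ ENNReal.ofReal_ne_top]
    refine lintegral_congr fun η => ?_
    ring
  simp_rw [h2]
  rw [lintegral_lintegral_swap (by fun_prop)]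
  refine lintegral_congr fun η => ?_
  rw [lintegral_const_mul _ (by fun_prop), rieszKernel]

theorem herbst_fourierInv {θ : ℝ} (h0 : 0 < θ) (h3 : θ < 3) {g : R3 → Spinor}
    (hg : Integrable g) (hgm : StronglyMeasurable g) :
    ∫⁻ x, ENNReal.ofReal (‖x‖ ^ (-θ)) * ‖𝓕⁻ g x‖ₑ ^ 2 ≤
      ENNReal.ofReal (herbstConst (θ / 2) ^ 2) *
        ∫⁻ ξ, ENNReal.ofReal (‖(2 * Real.pi) • ξ‖ ^ θ) * ‖g ξ‖ₑ ^ 2 := by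
  have hne : ∀ᵐ ξ : R3, ξ ≠ 0 := by simp [ae_iff]
  have hgm' : Measurable fun x => ‖g x‖ₑ := hgm.measurable.enorm
  set c := ENNReal.ofReal (Real.pi ^ (θ / 2) / Real.Gamma (θ / 2)) with hc
  rw [lintegral_norm_rpow_neg_mul h0
    ((continuous_fourierInv hg).measurable.enorm.pow_const 2)]
  calc c * ∫⁻ t in Set.Ioi (0 : ℝ), ENNReal.ofReal (t ^ (θ / 2 - 1)) *
        ∫⁻ x, ENNReal.ofReal (Real.exp (-(Real.pi * t * ‖x‖ ^ 2))) * ‖𝓕⁻ g x‖ₑ ^ 2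
      ≤ c * ∫⁻ t in Set.Ioi (0 : ℝ), ENNReal.ofReal (t ^ (θ / 2 - 1)) *
        (∫⁻ ξ, ∫⁻ η, ‖g ξ‖ₑ * ‖g η‖ₑ * ENNReal.ofReal (heatKernel t (ξ - η))) := by
        gcongr 1
        refine setLIntegral_mono' measurableSet_Ioi fun t ht => ?_
        exact mul_le_mul_right (lintegral_gaussian_mul_enorm_fourierInv_sq_le ht hg) _
    _ ≤ c * ∫⁻ ξ, ‖g ξ‖ₑ ^ 2 * ((∫⁻ η, rieszKernel (θ / 2) (ξ - η) *
          rieszKernel (3 / 4 - θ / 4) η) / rieszKernel (3 / 4 - θ / 4) ξ) := by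
        rw [lintegral_rpow_mul_lintegral_heatKernel _ hgm']
        gcongr 1
        have hpos : ∀ ξ : R3, ξ ≠ 0 → 0 < Real.Gamma (3 / 2 - (3 / 4 - θ / 4)) *
            (Real.pi * ‖ξ‖ ^ 2) ^ (3 / 4 - θ / 4 - 3 / 2) := fun ξ hξ => by
          have := norm_pos_iff.2 hξ
          have := Real.Gamma_pos_of_pos (show 0 < 3 / 2 - (3 / 4 - θ / 4) by linarith)
          positivity
        -- Away from the origin the weight is an explicit positive power, hence neither zero nor
        -- infinite.
        refine schur_test hgm' (measurable_rieszKernel _) (measurable_rieszKernel _) (fun _ => enorm_ne_top) ?_ ?_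
          (rieszKernel_neg _)
        · intro ξ hξ
          rw [rieszKernel_eq (by linarith) hξ]
          simpa using hpos ξ hξ
        · intro ξ hξ
          rw [rieszKernel_eq (by linarith) hξ]
          exact ENNReal.ofReal_ne_top
    _ = ENNReal.ofReal (herbstConst (θ / 2) ^ 2) *
        ∫⁻ ξ, ENNReal.ofReal (‖(2 * Real.pi) • ξ‖ ^ θ) * ‖g ξ‖ₑ ^ 2 := by
        rw [← lintegral_const_mul' _ _ ENNReal.ofReal_ne_top,
          ← lintegral_const_mul' _ _ ENNReal.ofReal_ne_top]
        refine lintegral_congr_ae ?_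
        filter_upwards [hne] with ξ hξ
        rw [mul_left_comm, riesz_ratio_eq h0 h3 hξ]
        ring

theorem eLpNorm_two_sq {g : R3 → Spinor} : eLpNorm g 2 volume ^ 2 = ∫⁻ x, ‖g x‖ₑ ^ 2 := by
  have h := eLpNorm_nnreal_pow_eq_lintegral (f := g) (μ := volume) (p := 2) (by norm_num)
  simpa using h

theorem exists_integrable_tendsto (g : Hrel) : ∃ G : ℕ → Hrel, (∀ n, Integrable (G n)) ∧
    (∀ n, ∀ᵐ ξ, ‖G n ξ‖ₑ ≤ ‖g ξ‖ₑ) ∧ Filter.Tendsto G Filter.atTop (nhds g) := by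
  have hm : ∀ n : ℕ, MemLp ((Metric.ball (0 : R3) n).indicator g) 2 volume :=
    fun n => (Lp.memLp g).indicator measurableSet_ball
  refine ⟨fun n => (hm n).toLp, fun n => ?_, fun n => ?_, ?_⟩
  · refine Integrable.congr ?_ (hm n).coeFn_toLp.symm
    rw [integrable_indicator_iff measurableSet_ball]
    have : IsFiniteMeasure (volume.restrict (Metric.ball (0 : R3) n)) :=
      ⟨by simpa using measure_ball_lt_top (μ := (volume : Measure R3)) (x := 0) (r := n)⟩
    exact (Lp.memLp g).restrict _ |>.integrable one_le_two
  · filter_upwards [(hm n).coeFn_toLp] with ξ hξ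
    rw [hξ, enorm_indicator_eq_indicator_enorm]
    exact Set.indicator_le_self _ _ _
  · suffices h : Filter.Tendsto (fun n => (hm n).toLp) Filter.atTop
        (nhds ((Lp.memLp g).toLp g)) by rwa [Lp.toLp_coeFn] at h
    rw [Lp.tendsto_Lp_iff_tendsto_eLpNorm'']
    have h2 : Filter.Tendsto (fun n : ℕ =>
        eLpNorm ((Metric.ball (0 : R3) n).indicator g - ⇑g) 2 volume ^ 2) Filter.atTop (nhds 0) := by
      simp_rw [eLpNorm_two_sq]
      have hfin : ∫⁻ x, ‖g x‖ₑ ^ 2 ≠ ∞ := by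
        rw [← eLpNorm_two_sq]
        exact ENNReal.pow_ne_top (Lp.eLpNorm_ne_top g)
      have hgm : Measurable g := (Lp.stronglyMeasurable g).measurable
      rw [← lintegral_zero (α := R3) (μ := volume)]
      refine tendsto_lintegral_of_dominated_convergence (fun x => ‖g x‖ₑ ^ 2) (fun n => ?_)
        (fun n => ?_) hfin ?_
      · exact (((hgm.indicator measurableSet_ball).sub hgm).enorm.pow_const 2)
      · filter_upwards with x
        -- The difference is `0` inside the ball and `-g` outside, so `‖g‖²` dominates.
        by_cases hx : x ∈ Metric.ball (0 : R3) n <;> simp [Set.indicator, hx]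
      · filter_upwards with x
        refine tendsto_const_nhds.congr' ?_
        obtain ⟨N, hN⟩ := exists_nat_gt ‖x‖
        filter_upwards [Filter.eventually_ge_atTop N] with n hn
        have hx : x ∈ Metric.ball (0 : R3) n := by
          rw [mem_ball_zero_iff]
          exact hN.trans_le (by exact_mod_cast hn)
        simp [hx]
    have h3 := (ENNReal.continuous_rpow_const (y := (1 / 2 : ℝ))).tendsto 0 |>.comp h2
    simp only [Function.comp_def] at h3
    convert h3 using 2
    · rw [← ENNReal.rpow_natCast, ← ENNReal.rpow_mul]; simp
    · simp

/-- The Herbst inequality `‖|x|^{-θ/2} f‖² ≤ M_{θ/2}² ‖|p̂|^{θ/2} f‖²`. -/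
theorem herbst {θ : ℝ} (h0 : 0 < θ) (h3 : θ < 3) (f : Hrel) :
    ∫⁻ x, ENNReal.ofReal (‖x‖ ^ (-θ)) * ‖f x‖ₑ ^ 2 ≤
      ENNReal.ofReal (herbstConst (θ / 2) ^ 2) *
        ∫⁻ ξ, ENNReal.ofReal (‖(2 * Real.pi) • ξ‖ ^ θ) * ‖(𝓕 f : Hrel) ξ‖ₑ ^ 2 := by
  obtain ⟨G, hGi, hGle, hGt⟩ := exists_integrable_tendsto (𝓕 f : Hrel)
  have ht : Filter.Tendsto (fun n => (𝓕⁻ (G n) : Hrel)) Filter.atTop (nhds f) := by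
    have h := ((Lp.fourierTransformₗᵢ R3 Spinor).symm.continuous.tendsto _).comp hGt
    have h2 : (Lp.fourierTransformₗᵢ R3 Spinor).symm (𝓕 f : Hrel) = f :=
      (Lp.fourierTransformₗᵢ R3 Spinor).symm_apply_apply f
    rw [h2] at h
    exact h
  -- Fatou needs pointwise convergence, available along a subsequence. The bound `hb` is uniform
  -- because truncation only decreases `‖𝓕 f‖` pointwise.
  obtain ⟨ns, -, hns⟩ := (tendstoInMeasure_of_tendsto_Lp ht).exists_seq_tendsto_ae
  have hb : ∀ n, ∫⁻ x, ENNReal.ofReal (‖x‖ ^ (-θ)) * ‖(𝓕⁻ (G n) : Hrel) x‖ₑ ^ 2 ≤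
      ENNReal.ofReal (herbstConst (θ / 2) ^ 2) *
        ∫⁻ ξ, ENNReal.ofReal (‖(2 * Real.pi) • ξ‖ ^ θ) * ‖(𝓕 f : Hrel) ξ‖ₑ ^ 2 := by
    intro n
    have h1 : ∫⁻ x, ENNReal.ofReal (‖x‖ ^ (-θ)) * ‖(𝓕⁻ (G n) : Hrel) x‖ₑ ^ 2 =
        ∫⁻ x, ENNReal.ofReal (‖x‖ ^ (-θ)) * ‖𝓕⁻ (G n : R3 → Spinor) x‖ₑ ^ 2 := by
      refine lintegral_congr_ae ?_
      filter_upwards [coeFn_fourierInv_ae_eq (hGi n)] with x hx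
      rw [hx]
    rw [h1]
    refine (herbst_fourierInv h0 h3 (hGi n) (Lp.stronglyMeasurable _)).trans ?_
    gcongr 1
    refine lintegral_mono_ae ?_
    filter_upwards [hGle n] with ξ hξ
    gcongr
  calc ∫⁻ x, ENNReal.ofReal (‖x‖ ^ (-θ)) * ‖f x‖ₑ ^ 2
      ≤ ∫⁻ x, Filter.liminf (fun n => ENNReal.ofReal (‖x‖ ^ (-θ)) *
          ‖(𝓕⁻ (G (ns n)) : Hrel) x‖ₑ ^ 2) Filter.atTop := by
        refine lintegral_mono_ae ?_
        filter_upwards [hns] with x hx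
        refine (Filter.Tendsto.liminf_eq ?_).ge
        refine ENNReal.Tendsto.const_mul ?_ (Or.inr ENNReal.ofReal_ne_top)
        exact (ENNReal.continuous_pow 2).tendsto _ |>.comp hx.enorm
    _ ≤ Filter.liminf (fun n => ∫⁻ x, ENNReal.ofReal (‖x‖ ^ (-θ)) *
          ‖(𝓕⁻ (G (ns n)) : Hrel) x‖ₑ ^ 2) Filter.atTop := by
        refine lintegral_liminf_le fun n => ?_
        have hm := (Lp.stronglyMeasurable (𝓕⁻ (G (ns n)) : Hrel)).measurable.enorm
        fun_prop
    _ ≤ _ := by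
        refine Filter.liminf_le_of_le (by isBoundedDefault) fun b hb' => ?_
        obtain ⟨n, hn⟩ := hb'.exists
        exact hn.trans (hb _)

/-! ### The operators on the Fourier side -/

theorem fourier_injective {f g : Hrel} (h : (𝓕 f : Hrel) = 𝓕 g) : f = g :=
  (Lp.fourierTransformₗᵢ R3 Spinor).injective h

theorem fourier_momentumOp (m : R3 → Matrix SpinIdx SpinIdx ℂ) (f : (momentumOp m).domain) :
    (𝓕 (momentumOp m f) : Hrel) =ᵐ[volume] momentumMul m f := by
  have h : (𝓕 (momentumOp m f) : Hrel) = MemLp.toLp (momentumMul m f.1) f.2 :=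
    fourier_fourierInv_eq (F := Hrel) _
  rw [h]
  exact MemLp.coeFn_toLp _

theorem momentumOp_eq_of_fourier {m : R3 → Matrix SpinIdx SpinIdx ℂ} {f : (momentumOp m).domain}
    {g : Hrel} (h : (𝓕 g : Hrel) =ᵐ[volume] momentumMul m f) : momentumOp m f = g := by
  refine fourier_injective (Lp.ext ?_)
  exact (fourier_momentumOp m f).trans h.symm

theorem integrable_schwartz_smul (ψ : SchwartzMap R3 ℂ) (f : Hrel) :
    Integrable fun x => ψ x • f x :=
  memLp_one_iff_integrable.1 ((Lp.memLp f).smul (ψ.memLp 2 volume))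

/-- A constant matrix acts on values and the Fourier transform on the test function, so they commute
as operations on tempered distributions. -/
theorem fourier_compLpL (T : Spinor →L[ℂ] Spinor) (f : Hrel) :
    (𝓕 (T.compLpL 2 volume f) : Hrel) = T.compLpL 2 volume (𝓕 f : Hrel) := by
  have hT : ∀ (g : Hrel) (ψ : SchwartzMap R3 ℂ), Lp.toTemperedDistribution (T.compLpL 2 volume g) ψ =
      T (Lp.toTemperedDistribution g ψ) := by
    intro g ψ
    rw [Lp.toTemperedDistribution_apply, Lp.toTemperedDistribution_apply,
      ← T.integral_comp_comm (integrable_schwartz_smul ψ g)]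
    refine integral_congr_ae ?_
    filter_upwards [T.coeFn_compLpL g] with x hx
    rw [hx, map_smul]
  refine LinearMap.ker_eq_bot.1 (Lp.ker_toTemperedDistributionCLM_eq_bot (F := Spinor)
      (μ := (volume : Measure R3)) (p := 2)) ?_
  ext1 ψ
  change Lp.toTemperedDistribution (𝓕 (T.compLpL 2 volume f) : Hrel) ψ =
    Lp.toTemperedDistribution (T.compLpL 2 volume (𝓕 f : Hrel)) ψ
  rw [hT, ← Lp.fourier_toTemperedDistribution_eq, ← Lp.fourier_toTemperedDistribution_eq,
    TemperedDistribution.fourier_apply, TemperedDistribution.fourier_apply, hT]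

theorem fourier_Pplus (f : Hrel) :
    (𝓕 (Pplus f) : Hrel) =ᵐ[volume] fun ξ => act (PplusSymbol ((2 * Real.pi) • ξ)) ((𝓕 f : Hrel) ξ) := by
  have h : Pplus f = (1 / 2 : ℂ) • (f + momentumOp tauSymbol ⟨f, tau_domain f⟩) := rfl
  have h2 : (𝓕 (Pplus f) : Hrel) =
      (1 / 2 : ℂ) • ((𝓕 f : Hrel) + 𝓕 (momentumOp tauSymbol ⟨f, tau_domain f⟩)) := by
    rw [h, FourierSMul.fourier_smul, FourierAdd.fourier_add]
  rw [h2]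
  filter_upwards [Lp.coeFn_smul (1 / 2 : ℂ)
    ((𝓕 f : Hrel) + 𝓕 (momentumOp tauSymbol ⟨f, tau_domain f⟩)),
    Lp.coeFn_add (𝓕 f : Hrel) (𝓕 (momentumOp tauSymbol ⟨f, tau_domain f⟩)),
    fourier_momentumOp tauSymbol ⟨f, tau_domain f⟩] with ξ h1 h2 h3
  rw [h1, Pi.smul_apply, h2, Pi.add_apply, h3]
  simp [PplusSymbol, momentumMul]

theorem ae_two_pi_smul_ne_zero : ∀ᵐ ξ : R3, (2 * Real.pi) • ξ ≠ 0 := by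
  have h : ∀ᵐ ξ : R3, ξ ≠ 0 := by simp [ae_iff]
  filter_upwards [h] with ξ hξ
  exact smul_ne_zero (by positivity) hξ

theorem act_PplusSymbol_of_mem_Hplus {f : Hrel} (hf : f ∈ Hplus) :
    ∀ᵐ ξ, act (PplusSymbol ((2 * Real.pi) • ξ)) ((𝓕 f : Hrel) ξ) = (𝓕 f : Hrel) ξ := by
  obtain ⟨g, rfl⟩ := hf
  filter_upwards [fourier_Pplus g, ae_two_pi_smul_ne_zero] with ξ h1 h2
  rw [h1, ← mul_apply_eq_comp, ← map_mul, PplusSymbol_mul_PplusSymbol h2]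

theorem Pplus_of_mem_Hplus {f : Hrel} (hf : f ∈ Hplus) : Pplus f = f := by
  refine fourier_injective (Lp.ext ?_)
  filter_upwards [fourier_Pplus f, act_PplusSymbol_of_mem_Hplus hf] with ξ h1 h2
  rw [h1, h2]

theorem fourier_A0 (f : A0.domain) :
    (𝓕 (A0 f) : Hrel) =ᵐ[volume] momentumMul A0Symbol f := by
  have h : A0 f = momentumOp MminusDot ⟨f, Dplus_le f.2⟩ +
    (act B).compLpL 2 volume (Pplus f) := rfl
  rw [h, FourierAdd.fourier_add, fourier_compLpL]
  filter_upwards [Lp.coeFn_add (𝓕 (momentumOp MminusDot ⟨f, Dplus_le f.2⟩) : Hrel)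
      ((act B).compLpL 2 volume (𝓕 (Pplus f) : Hrel)),
    (act B).coeFn_compLpL (𝓕 (Pplus f) : Hrel), fourier_Pplus f,
    fourier_momentumOp MminusDot ⟨f, Dplus_le f.2⟩] with ξ h1 h2 h3 h4
  rw [h1, Pi.add_apply, h2, h3, h4]
  simp [momentumMul, A0Symbol]

theorem act_smul_apply (c : ℂ) (A : Matrix SpinIdx SpinIdx ℂ) (v : Spinor) :
    act (c • A) v = c • act A v := by
  simp only [map_smul, smul_apply]

theorem momentumMul_absA0Symbol {f : Hrel} (hf : f ∈ Hplus) :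
    momentumMul absA0Symbol f =ᵐ[volume] fun ξ =>
      ((2 * Real.sqrt (‖(2 * Real.pi) • ξ‖ ^ 2 + 1) : ℝ) : ℂ) • (𝓕 f : Hrel) ξ := by
  filter_upwards [act_PplusSymbol_of_mem_Hplus hf, ae_two_pi_smul_ne_zero] with ξ h1 h2
  rw [momentumMul, absA0Symbol_eq h2, act_smul_apply, h1]

theorem inner_self_eq_ofReal (v : Spinor) : inner ℂ v v = ((‖v‖ ^ 2 : ℝ) : ℂ) := by
  rw [inner_self_eq_norm_sq_to_K]
  push_cast
  rfl

/-- On the range of `P₊(p)` the matrix `A₀(p)†A₀(p)` is a scalar, so `A₀(p)` is a multiple of an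
isometry there. -/
theorem norm_sq_act_A0Symbol {p : R3} (hp : p ≠ 0) {v : Spinor}
    (hv : act (PplusSymbol p) v = v) :
    ‖act (A0Symbol p) v‖ ^ 2 = 4 * (‖p‖ ^ 2 + 1) * ‖v‖ ^ 2 := by
  have h1 : inner ℂ (act (A0Symbol p) v) (act (A0Symbol p) v) =
      ((4 * (‖p‖ ^ 2 + 1) : ℝ) : ℂ) * inner ℂ v v := by
    rw [← ContinuousLinearMap.adjoint_inner_right, ← ContinuousLinearMap.star_eq_adjoint,
      ← map_star, ← mul_apply_eq_comp, ← map_mul, star_A0Symbol_mul_A0Symbol hp,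
      act_smul_apply, hv, inner_smul_right]
  rw [inner_self_eq_ofReal, inner_self_eq_ofReal] at h1
  exact_mod_cast h1

theorem ofReal_norm_Lp_sq (f : Hrel) : ENNReal.ofReal (‖f‖ ^ 2) = ∫⁻ x, ‖f x‖ₑ ^ 2 := by
  rw [← eLpNorm_two_sq, ENNReal.ofReal_pow (norm_nonneg _), Lp.norm_def,
    ENNReal.ofReal_toReal (Lp.eLpNorm_ne_top f)]

theorem ofReal_norm_A0_sq (f : A0.domain) : ENNReal.ofReal (‖A0 f‖ ^ 2) =
    4 * ∫⁻ ξ, ENNReal.ofReal (‖(2 * Real.pi) • ξ‖ ^ 2 + 1) * ‖(𝓕 (f : Hrel) : Hrel) ξ‖ₑ ^ 2 := by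
  rw [← Lp.norm_fourier_eq, ofReal_norm_Lp_sq, ← lintegral_const_mul' _ _ (by norm_num)]
  refine lintegral_congr_ae ?_
  have hf : (f : Hrel) ∈ Hplus := f.2.2
  filter_upwards [fourier_A0 f, act_PplusSymbol_of_mem_Hplus hf, ae_two_pi_smul_ne_zero]
    with ξ h1 h2 h3
  have h4 := norm_sq_act_A0Symbol h3 h2
  rw [h1, momentumMul, ← ofReal_norm, ← ofReal_norm, ← ENNReal.ofReal_pow (norm_nonneg _), h4,
    ENNReal.ofReal_mul (by positivity), ENNReal.ofReal_mul (by norm_num),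
    ENNReal.ofReal_pow (norm_nonneg _), mul_assoc]
  norm_num

/-! ### The operator bound for the potential -/

theorem enorm_potentialMul_sq (κ : ℝ) (f : Hrel) (r : R3) :
    ‖potentialMul κ f r‖ₑ ^ 2 = ENNReal.ofReal (‖r‖ ^ (-(2 * κ))) * ‖f r‖ₑ ^ 2 := by
  rw [potentialMul, enorm_smul, mul_pow, ← ofReal_norm, Complex.norm_real, Real.norm_eq_abs,
    abs_of_nonneg (by positivity), ← ENNReal.ofReal_pow (by positivity), ← Real.rpow_mul_natCast
    (norm_nonneg _)]
  congr 3
  push_cast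
  ring

/-- The power is at most `1` for `r ≤ 1` and at most `r²` for `r ≥ 1`. Applied with exponent `2κ`,
this is where `κ ≤ 1` enters the comparison with the mass term. -/
theorem rpow_le_sq_add_one {r θ : ℝ} (hr : 0 ≤ r) (h0 : 0 ≤ θ) (h2 : θ ≤ 2) :
    r ^ θ ≤ r ^ 2 + 1 := by
  rcases le_total r 1 with h | h
  · have := Real.rpow_le_one hr h h0
    nlinarith [sq_nonneg r]
  · have := Real.rpow_le_rpow_of_exponent_le h h2
    rw [Real.rpow_two] at this
    linarith

theorem herbstConst_nonneg {κ : ℝ} (h0 : 0 ≤ κ) (h1 : κ ≤ 1) : 0 ≤ herbstConst κ := by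
  have := Real.Gamma_pos_of_pos (show 0 < 3 / 4 - κ / 2 by linarith)
  have := Real.Gamma_pos_of_pos (show 0 < 3 / 4 + κ / 2 by linarith)
  unfold herbstConst
  positivity

theorem aestronglyMeasurable_potentialMul (κ : ℝ) (f : Hrel) :
    AEStronglyMeasurable (potentialMul κ f) volume := by
  have h : Measurable fun r : R3 => ((‖r‖ ^ (-κ) : ℝ) : ℂ) := by fun_prop
  exact h.aestronglyMeasurable.smul (Lp.aestronglyMeasurable f)

theorem lintegral_enorm_potentialMul_sq_le {κ : ℝ} (hκ0 : 0 < κ) (hκ1 : κ ≤ 1) (f : A0.domain) :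
    ∫⁻ r, ‖potentialMul κ f r‖ₑ ^ 2 ≤ ENNReal.ofReal ((herbstConst κ / 2 * ‖A0 f‖) ^ 2) := by
  -- The squared norm contains the squared potential, hence the exponent `2κ ≤ 2 < 3`.
  have h := herbst (θ := 2 * κ) (by linarith) (by linarith) (f : Hrel)
  rw [mul_div_cancel_left₀ κ (two_ne_zero)] at h
  simp_rw [enorm_potentialMul_sq]
  refine h.trans ?_
  have h2 : (herbstConst κ / 2 * ‖A0 f‖) ^ 2 = herbstConst κ ^ 2 * (4⁻¹ * ‖A0 f‖ ^ 2) := by ring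
  rw [h2, ENNReal.ofReal_mul (by positivity), ENNReal.ofReal_mul (by positivity),
    ofReal_norm_A0_sq, ← mul_assoc (ENNReal.ofReal 4⁻¹)]
  have h3 : ENNReal.ofReal 4⁻¹ * 4 = 1 := by
    rw [ENNReal.ofReal_inv_of_pos (by norm_num)]
    have : ENNReal.ofReal 4 = 4 := by norm_num
    rw [this, ENNReal.inv_mul_cancel (by norm_num) (by norm_num)]
  rw [h3, one_mul]
  gcongr with ξ
  exact rpow_le_sq_add_one (norm_nonneg _) (by linarith) (by linarith)

theorem mem_potential_domain_and_norm_le {κ : ℝ} (hκ0 : 0 < κ) (hκ1 : κ ≤ 1) (f : A0.domain) :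
    ∃ hV : (f : Hrel) ∈ (potential κ).domain,
      ‖potential κ ⟨f, hV⟩‖ ≤ herbstConst κ / 2 * ‖A0 f‖ := by
  have h := lintegral_enorm_potentialMul_sq_le hκ0 hκ1 f
  have hc := herbstConst_nonneg hκ0.le hκ1
  have hV : MemLp (potentialMul κ f) 2 volume := by
    refine ⟨aestronglyMeasurable_potentialMul κ f, ?_⟩
    have h2 : eLpNorm (potentialMul κ f) 2 volume ^ 2 < ∞ := by
      rw [eLpNorm_two_sq]
      exact h.trans_lt ENNReal.ofReal_lt_top
    simpa using h2
  refine ⟨hV, ?_⟩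
  have h3 : ENNReal.ofReal (‖(hV.toLp : Hrel)‖ ^ 2) ≤
      ENNReal.ofReal ((herbstConst κ / 2 * ‖A0 f‖) ^ 2) := by
    refine le_trans (le_of_eq ?_) h
    rw [ofReal_norm_Lp_sq]
    refine lintegral_congr_ae ?_
    filter_upwards [hV.coeFn_toLp] with x hx
    rw [hx]
  rw [ENNReal.ofReal_le_ofReal_iff (by positivity)] at h3
  exact (pow_le_pow_iff_left₀ (norm_nonneg _) (by positivity) two_ne_zero).1 h3

/-! ### Comparison of momentum weights and the form bound -/

theorem sqrt_le_two_pi_mul_sqrt (ξ : R3) :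
    Real.sqrt (‖(2 * Real.pi) • ξ‖ ^ 2 + 1) ≤ 2 * Real.pi * Real.sqrt (1 + ‖ξ‖ ^ 2) := by
  refine Real.sqrt_le_iff.2 ⟨by positivity, ?_⟩
  rw [mul_pow, Real.sq_sqrt (by positivity), norm_smul, Real.norm_eq_abs,
    abs_of_pos (by positivity)]
  nlinarith [Real.pi_gt_three, sq_nonneg ‖ξ‖]

/-- Together with `sqrt_le_two_pi_mul_sqrt`, this makes the weight in `p = 2πξ` equivalent to the
Sobolev weight in `ξ`; the factor `2π` affects only constants. -/
theorem sqrt_le_sqrt_two_pi (ξ : R3) :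
    Real.sqrt (1 + ‖ξ‖ ^ 2) ≤ Real.sqrt (‖(2 * Real.pi) • ξ‖ ^ 2 + 1) := by
  refine Real.sqrt_le_sqrt ?_
  rw [norm_smul, Real.norm_eq_abs, abs_of_pos (by positivity)]
  have h : (1 : ℝ) ≤ (2 * Real.pi) ^ 2 := by nlinarith [Real.pi_gt_three]
  nlinarith [sq_nonneg ‖ξ‖, mul_le_mul_of_nonneg_right h (sq_nonneg ‖ξ‖)]

theorem absA0Density_ae_eq {f : Hrel} (hf : f ∈ Hplus) :
    absA0Density f =ᵐ[volume] fun ξ =>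
      2 * (Real.sqrt (‖(2 * Real.pi) • ξ‖ ^ 2 + 1) * ‖(𝓕 f : Hrel) ξ‖ ^ 2) := by
  filter_upwards [momentumMul_absA0Symbol hf] with ξ hξ
  rw [absA0Density, hξ, inner_smul_right, inner_self_eq_ofReal,
    ← Complex.ofReal_mul, Complex.ofReal_re]
  ring

theorem potentialDensity_eq (κ : ℝ) (f : Hrel) :
    potentialDensity κ f = fun r => ‖r‖ ^ (-κ) * ‖f r‖ ^ 2 := by
  ext r
  rw [potentialDensity, potentialMul, inner_smul_right, inner_self_eq_ofReal,
    ← Complex.ofReal_mul, Complex.ofReal_re]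

theorem integrable_norm_sq (g : Hrel) : Integrable fun ξ => ‖g ξ‖ ^ 2 :=
  (Lp.memLp g).integrable_norm_pow two_ne_zero

theorem integrable_absA0Density {f : Hrel} (hf : f ∈ Sobolev (1 / 2)) (hf' : f ∈ Hplus) :
    Integrable (absA0Density f) := by
  refine Integrable.congr ?_ (absA0Density_ae_eq hf').symm
  obtain ⟨g, hg⟩ := sobolev_fourier (by norm_num) hf
  refine ((integrable_norm_sq g).const_mul (2 * (2 * Real.pi))).mono' ?_ ?_
  · have h1 : Measurable fun ξ : R3 => Real.sqrt (‖(2 * Real.pi) • ξ‖ ^ 2 + 1) := by fun_prop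
    exact (h1.aestronglyMeasurable.mul ((Lp.aestronglyMeasurable _).norm.pow 2)).const_mul 2
  · filter_upwards [hg] with ξ hξ
    have h0 : 0 < 1 + ‖ξ‖ ^ 2 := by positivity
    rw [Real.norm_eq_abs, abs_of_nonneg (by positivity), hξ, norm_smul _ (g ξ), Complex.norm_real,
      Real.norm_eq_abs, abs_of_nonneg (by positivity), mul_pow]
    have h2 : ((1 + ‖ξ‖ ^ 2) ^ (-(1 / 2) / 2 : ℝ)) ^ 2 = (Real.sqrt (1 + ‖ξ‖ ^ 2))⁻¹ := by
      rw [← Real.rpow_mul_natCast h0.le, Real.sqrt_eq_rpow, ← Real.rpow_neg h0.le]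
      congr 1
      norm_num
    have h3 := sqrt_le_two_pi_mul_sqrt ξ
    have h4 : 0 < Real.sqrt (1 + ‖ξ‖ ^ 2) := Real.sqrt_pos.2 h0
    have h5 : Real.sqrt (‖(2 * Real.pi) • ξ‖ ^ 2 + 1) * (Real.sqrt (1 + ‖ξ‖ ^ 2))⁻¹ ≤
        2 * Real.pi := by rwa [← div_eq_mul_inv, div_le_iff₀ h4]
    rw [h2, ← mul_assoc (Real.sqrt _), ← mul_assoc 2]
    exact mul_le_mul_of_nonneg_right (mul_le_mul_of_nonneg_left h5 zero_le_two) (sq_nonneg _)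

theorem form_inequality {κ : ℝ} (hκ0 : 0 < κ) (hκ1 : κ ≤ 1) {f : Hrel}
    (hf : f ∈ Sobolev (1 / 2)) (hf' : f ∈ Hplus) :
    Integrable (potentialDensity κ f) ∧ Integrable (absA0Density f) ∧
      (∫ r, potentialDensity κ f r) ≤
        herbstConst (κ / 2) ^ 2 / 2 * (∫ ξ, absA0Density f ξ) := by
  have hA := integrable_absA0Density hf hf'
  have hApos : 0 ≤ᵐ[volume] absA0Density f := by
    filter_upwards [absA0Density_ae_eq hf'] with ξ hξ
    rw [hξ, Pi.zero_apply]
    positivity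
  have hApos' := integral_nonneg_of_ae hApos
  have hVpos : 0 ≤ potentialDensity κ f := by
    intro r
    rw [potentialDensity_eq, Pi.zero_apply]
    positivity
  have hVm : AEStronglyMeasurable (potentialDensity κ f) volume := by
    rw [potentialDensity_eq]
    have h1 : Measurable fun r : R3 => ‖r‖ ^ (-κ) := by fun_prop
    exact h1.aestronglyMeasurable.mul ((Lp.aestronglyMeasurable _).norm.pow 2)
  have hle : ∫⁻ r, ENNReal.ofReal (potentialDensity κ f r) ≤
      ENNReal.ofReal (herbstConst (κ / 2) ^ 2 / 2 * (∫ ξ, absA0Density f ξ)) := by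
    have h := herbst hκ0 (by linarith) f
    have h1 : ∫⁻ r, ENNReal.ofReal (potentialDensity κ f r) =
        ∫⁻ x, ENNReal.ofReal (‖x‖ ^ (-κ)) * ‖f x‖ₑ ^ 2 := by
      refine lintegral_congr fun r => ?_
      rw [potentialDensity_eq, ENNReal.ofReal_mul (by positivity),
        ENNReal.ofReal_pow (norm_nonneg _), ofReal_norm]
    rw [h1]
    refine h.trans ?_
    -- The factor `1/2` is moved onto the form of `|A₀|`, where it cancels the `2` in `2(|p|² +
    -- 1)^{1/2}`.
    rw [div_mul_eq_mul_div, mul_div_assoc, ENNReal.ofReal_mul (by positivity)]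
    gcongr 1
    rw [← integral_div, ofReal_integral_eq_lintegral_ofReal (hA.div_const 2)
      (hApos.mono fun ξ hξ => div_nonneg hξ zero_le_two)]
    refine lintegral_mono_ae ?_
    filter_upwards [absA0Density_ae_eq hf'] with ξ hξ
    rw [hξ, mul_div_cancel_left₀ _ two_ne_zero, ENNReal.ofReal_mul (by positivity),
      ENNReal.ofReal_pow (norm_nonneg _), ofReal_norm]
    gcongr
    -- Squaring turns `|p|^κ ≤ (|p|² + 1)^{1/2}` into the bound on `|p|^{2κ}`.
    refine Real.le_sqrt_of_sq_le ?_
    rw [← Real.rpow_mul_natCast (norm_nonneg _)]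
    exact rpow_le_sq_add_one (norm_nonneg _) (by positivity) (by push_cast; linarith)
  have hV : Integrable (potentialDensity κ f) := by
    refine ⟨hVm, ?_⟩
    rw [hasFiniteIntegral_iff_ofReal (Filter.Eventually.of_forall hVpos)]
    exact hle.trans_lt ENNReal.ofReal_lt_top
  refine ⟨hV, hA, ?_⟩
  rw [← ofReal_integral_eq_lintegral_ofReal hV (Filter.Eventually.of_forall hVpos),
    ENNReal.ofReal_le_ofReal_iff (by positivity)] at hle
  exact hle

/-! ### The domain and the action of `|A₀|` -/

theorem mem_Sobolev_one_of_memLp {f : Hrel}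
    (hf : MemLp (fun ξ => ((Real.sqrt (1 + ‖ξ‖ ^ 2) : ℝ) : ℂ) • (𝓕 f : Hrel) ξ) 2 volume) :
    f ∈ Sobolev 1 := by
  refine TemperedDistribution.memSobolev_iff_exists_smulLeftCLM_fourier.2 ⟨hf.toLp, ?_⟩
  rw [Lp.fourier_toTemperedDistribution_eq]
  ext1 ψ
  rw [TemperedDistribution.smulLeftCLM_apply_apply, Lp.toTemperedDistribution_apply,
    Lp.toTemperedDistribution_apply]
  refine integral_congr_ae ?_
  filter_upwards [hf.coeFn_toLp] with ξ hξ
  rw [hξ, SchwartzMap.smulLeftCLM_apply_apply (by fun_prop), Real.sqrt_eq_rpow, smul_smul,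
    smul_eq_mul, mul_comm]

/-- On `Hplus` the symbol acts as the scalar `2(|p|² + 1)^{1/2}`, so each direction is one half of
the equivalence with the `H¹` weight. -/
theorem memLp_momentumMul_absA0Symbol_iff {f : Hrel} (hf : f ∈ Hplus) :
    MemLp (momentumMul absA0Symbol f) 2 volume ↔ f ∈ Sobolev 1 := by
  rw [memLp_congr_ae (momentumMul_absA0Symbol hf)]
  constructor
  · intro h
    refine mem_Sobolev_one_of_memLp (h.mono ?_ ?_)
    · have h1 : Measurable fun ξ : R3 => ((Real.sqrt (1 + ‖ξ‖ ^ 2) : ℝ) : ℂ) := by fun_prop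
      exact h1.aestronglyMeasurable.smul (Lp.aestronglyMeasurable _)
    · filter_upwards with ξ
      rw [norm_smul, norm_smul, Complex.norm_real, Complex.norm_real, Real.norm_eq_abs,
        Real.norm_eq_abs, abs_of_nonneg (by positivity), abs_of_nonneg (by positivity)]
      gcongr
      have := sqrt_le_sqrt_two_pi ξ
      have := Real.sqrt_nonneg (‖(2 * Real.pi) • ξ‖ ^ 2 + 1)
      linarith
  · intro h
    obtain ⟨g, hg⟩ := sobolev_fourier zero_le_one h
    refine MemLp.of_le_mul (c := 2 * (2 * Real.pi)) (Lp.memLp g) ?_ ?_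
    · have h1 : Measurable fun ξ : R3 =>
          ((2 * Real.sqrt (‖(2 * Real.pi) • ξ‖ ^ 2 + 1) : ℝ) : ℂ) := by fun_prop
      exact h1.aestronglyMeasurable.smul (Lp.aestronglyMeasurable _)
    · filter_upwards [hg] with ξ hξ
      have h0 : 0 < 1 + ‖ξ‖ ^ 2 := by positivity
      have h2 : (1 + ‖ξ‖ ^ 2) ^ (-1 / 2 : ℝ) = (Real.sqrt (1 + ‖ξ‖ ^ 2))⁻¹ := by
        rw [Real.sqrt_eq_rpow, ← Real.rpow_neg h0.le]
        congr 1
        norm_num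
      have h3 := sqrt_le_two_pi_mul_sqrt ξ
      have h4 : 0 < Real.sqrt (1 + ‖ξ‖ ^ 2) := Real.sqrt_pos.2 h0
      rw [hξ, smul_smul, ← Complex.ofReal_mul, norm_smul _ (g ξ), Complex.norm_real,
        Real.norm_eq_abs, abs_of_nonneg (by positivity), h2, mul_assoc 2]
      refine mul_le_mul_of_nonneg_right (mul_le_mul_of_nonneg_left ?_ zero_le_two) (norm_nonneg _)
      rwa [← div_eq_mul_inv, div_le_iff₀ h4]

theorem absA0_domain : absA0.domain = Dplus := by
  ext f
  change f ∈ Hplus ∧ MemLp (momentumMul absA0Symbol f) 2 volume ↔ f ∈ Sobolev 1 ∧ f ∈ Hplus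
  constructor
  · rintro ⟨h1, h2⟩
    exact ⟨(memLp_momentumMul_absA0Symbol_iff h1).1 h2, h1⟩
  · rintro ⟨h1, h2⟩
    exact ⟨h2, (memLp_momentumMul_absA0Symbol_iff h2).2 h1⟩

theorem absA0_eq (f : absA0.domain) : ∃ hf : Pplus f ∈ sqrtOp.domain,
    absA0 f = (2 : ℂ) • sqrtOp ⟨Pplus f, hf⟩ := by
  obtain ⟨h1, h2⟩ : (f : Hrel) ∈ Hplus ∧ MemLp (momentumMul absA0Symbol f) 2 volume := f.2
  have hP := Pplus_of_mem_Hplus h1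
  have h3 : momentumMul absA0Symbol f =ᵐ[volume] (2 : ℂ) •
      momentumMul (fun p => ((Real.sqrt (‖p‖ ^ 2 + 1) : ℝ) : ℂ) • 1) (Pplus f) := by
    filter_upwards [momentumMul_absA0Symbol h1] with ξ hξ
    rw [hξ, hP, Pi.smul_apply, momentumMul, act_smul_apply, act, map_one,
      one_apply_eq_self, smul_smul]
    push_cast
    rfl
  have hf : MemLp (momentumMul (fun p => ((Real.sqrt (‖p‖ ^ 2 + 1) : ℝ) : ℂ) • 1) (Pplus f)) 2
      volume := by
    have h4 := ((memLp_congr_ae h3).1 h2).const_smul (2⁻¹ : ℂ)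
    rwa [smul_smul, inv_mul_cancel₀ two_ne_zero, one_smul] at h4
  refine ⟨hf, ?_⟩
  change momentumOp absA0Symbol ⟨f, h2⟩ = _
  refine momentumOp_eq_of_fourier ?_
  rw [FourierSMul.fourier_smul]
  filter_upwards [Lp.coeFn_smul (2 : ℂ) (𝓕 (sqrtOp ⟨Pplus f, hf⟩) : Hrel), h3,
    fourier_momentumOp _ ⟨Pplus f, hf⟩] with ξ e1 e2 e3
  rw [e1, e2, Pi.smul_apply, Pi.smul_apply]
  exact congrArg _ e3

end TwoBodyDirac

end

theorem mainTheorem7 (κ : ℝ) (hκ0 : 0 < κ) (hκ1 : κ ≤ 1) :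
    (∀ f : TwoBodyDirac.A0.domain,
      ∃ hV : (f : TwoBodyDirac.Hrel) ∈ (TwoBodyDirac.potential κ).domain,
        ‖TwoBodyDirac.potential κ ⟨f, hV⟩‖ ≤
          TwoBodyDirac.herbstConst κ / 2 * ‖TwoBodyDirac.A0 f‖) ∧
    (∀ f : TwoBodyDirac.Hrel, f ∈ TwoBodyDirac.Sobolev (1 / 2) → f ∈ TwoBodyDirac.Hplus →
      Integrable (TwoBodyDirac.potentialDensity κ f) ∧
      Integrable (TwoBodyDirac.absA0Density f) ∧
      (∫ r, TwoBodyDirac.potentialDensity κ f r) ≤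
        TwoBodyDirac.herbstConst (κ / 2) ^ 2 / 2 * (∫ ξ, TwoBodyDirac.absA0Density f ξ)) ∧
    TwoBodyDirac.absA0.domain = TwoBodyDirac.Dplus ∧
    (∀ f : TwoBodyDirac.absA0.domain,
      ∃ hf : TwoBodyDirac.Pplus f ∈ TwoBodyDirac.sqrtOp.domain,
        TwoBodyDirac.absA0 f = (2 : ℂ) • TwoBodyDirac.sqrtOp ⟨TwoBodyDirac.Pplus f, hf⟩) :=
  ⟨fun f => TwoBodyDirac.mem_potential_domain_and_norm_le hκ0 hκ1 f,
    fun _ hf hf' => TwoBodyDirac.form_inequality hκ0 hκ1 hf hf',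
    TwoBodyDirac.absA0_domain, TwoBodyDirac.absA0_eq⟩
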